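/- Let $R$ be a commutative ring containing $\mathbb{Q}$ (e.g. $R=\mathbb{Q}$), let $n$ be an integer and let $r\ge 0$. A forested graph with $r$ hairs is a finite connected undirected graph $\gamma$ (tadpoles and multiple edges are allowed) with $r$ univalent vertices numbered $1,\dots,r$ (the hairs), all other (internal) vertices having valence at least $3$, together with a set $T$ of edges, called the marked edges, that contains no edge incident to a hair and no cycle. An orientation $\mathit{or}$ is an ordering, up to even permutations, of the set of marked edges if $n$ is even, and of the set of internal vertices, half-edges and unmarked edges if $n$ is odd; it is written as a monomial in the exterior algebra on these symbols. Let $\mathsf{FG}_n(r)$ be the $R$-module spanned by the triples $(\gamma,T,\mathit{or})$ modulo isomorphism (preserving the numbering of the hairs and the set $T$) and $(\gamma,T,-\mathit{or})=-(\gamma,T,\mathit{or})$, graded by the number of marked edges, with the differential $d=d_c+d_u$ of degree $-1$, where $$d_c(\gamma,T,\mathit{or})=\sum_{e\in T}(\gamma/e,T\setminus\{e\},\partial_e\mathit{or}),\qquad d_u(\gamma,T,\mathit{or})=\sum_{e\in T}(\gamma,T\setminus\{e\},\partial_e\mathit{or})$$ for $n$ even, and $$d_c(\gamma,T,\mathit{or})=\sum_{e\in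 T}(\gamma/e,T\setminus\{e\},v_e\wedge\partial_{v_e^1}\partial_{v_e^2}\partial_{h_e^1}\partial_{h_e^2}\mathit{or}),\qquad d_u(\gamma,T,\mathit{or})=\sum_{e\in T}(\gamma,T\setminus\{e\},e\wedge\mathit{or})$$ for $n$ odd. Here $\gamma/e$ is obtained by contracting $e$, $v_e$ is the new vertex, $h_e^1,h_e^2$ are the half-edges of $e$ and $v_e^1,v_e^2$ the vertices to which they are respectively incident, and $\partial_x$ is the (left, odd) partial derivative with respect to the symbol $x$. The differential preserves the loop order (first Betti number); let $\mathsf{FG}_n^{g\text{-loop}}(r)$ be the part of loop order $g$. A graph is bridgeless if no edge, other than those incident to hairs, disconnects it when removed. The bridgeless forested graphs span a subcomplex $\mathsf{FG}_n^{bl,g\text{-loop}}(r)\subset\mathsf{FG}_n^{g\text{-loop}}(r)$. **Proposition.** For every integer $n$, every $r\ge 0$ and every $g\ge 1$, the inclusion $$\bigl(\mathsf{FG}_n^{bl,g\text{-loop}}(r),\,d_c+d_u\bigr)\subset\bigl(\mathsf{FG}_n^{g\text{-loop}}(r),\,d_c+d_u\bigr)$$ is a quasi-isomorphism. -/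

import Mathlib

/-!
Forested graph complexes over a commutative ring `R`.

Graphs are encoded by half-edges, which are natural numbers.  A vertex is the finite set of
half-edges incident to it, an edge is an unordered pair of half-edges.  Hence tadpoles and multiple
edges are allowed, and edge contraction does not require any renaming.
-/

open CategoryTheory

noncomputable section

namespace ForestedGraphs

universe u

/-- The data of a graph with `r` numbered hairs and a set of marked edges; see
`MarkedGraph.Admissible` for the conditions on these data. -/
@[ext]
structure MarkedGraph (r : ℕ) where
  /-- The vertices (including the univalent hair vertices), as sets of half-edges. -/
  V : Finset (Finset ℕ)
  /-- The edges (including those incident to the hair vertices), as pairs of half-edges. -/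
  E : Finset (Sym2 ℕ)
  /-- The half-edge at the `i`-th hair vertex; this vertex is `{hair i}`. -/
  hair : Fin r → ℕ
  /-- The marked edges. -/
  T : Finset (Sym2 ℕ)

namespace MarkedGraph

variable {r : ℕ} (Γ : MarkedGraph r)

/-- The set of half-edges. -/
def H : Finset ℕ := Γ.V.sup id

/-- The vertex to which a half-edge is incident (if the vertices are pairwise disjoint). -/
def vertexOf (h : ℕ) : Finset ℕ := (Γ.V.filter (fun v => h ∈ v)).sup id

/-- `Γ.Linked S a b`: the half-edges `a` and `b` are incident to vertices that are joined by a path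
all of whose edges belong to `S`. -/
def Linked (S : Finset (Sym2 ℕ)) : ℕ → ℕ → Prop :=
  Relation.EqvGen fun a b => (∃ v ∈ Γ.V, a ∈ v ∧ b ∈ v) ∨ s(a, b) ∈ S

/-- The graph with vertices those of `Γ` and with edge set `S` is connected. -/
def ConnectedBy (S : Finset (Sym2 ℕ)) : Prop :=
  Γ.H.Nonempty ∧ ∀ a ∈ Γ.H, ∀ b ∈ Γ.H, Γ.Linked S a b

/-- Admissible forested graphs with `r` hairs. -/
structure Admissible : Prop where
  /-- Every half-edge is incident to exactly one vertex. -/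
  disjoint : ∀ v ∈ Γ.V, ∀ w ∈ Γ.V, ∀ h, h ∈ v → h ∈ w → v = w
  /-- An edge consists of two distinct half-edges. -/
  edge_ne : ∀ e ∈ Γ.E, ¬ e.IsDiag
  edge_mem : ∀ e ∈ Γ.E, ∀ h ∈ e, h ∈ Γ.H
  /-- Every half-edge belongs to exactly one edge. -/
  edge_unique : ∀ h ∈ Γ.H, ∃! e, e ∈ Γ.E ∧ h ∈ e
  /-- There are `r` different numbered univalent vertices. -/
  hair_injective : Function.Injective Γ.hair
  hair_mem : ∀ i, {Γ.hair i} ∈ Γ.V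
  /-- All other vertices are at least trivalent. -/
  valence : ∀ v ∈ Γ.V, (∀ i, v ≠ {Γ.hair i}) → 3 ≤ v.card
  connected : Γ.ConnectedBy Γ.E
  marked_subset : Γ.T ⊆ Γ.E
  /-- Edges incident to hair vertices are not marked. -/
  marked_hair : ∀ e ∈ Γ.T, ∀ i, Γ.hair i ∉ e
  /-- The marked edges form a forest: the endpoints of a marked edge are not joined by a path of
  other marked edges (in particular, a marked edge is not a tadpole). -/
  forest : ∀ a b, s(a, b) ∈ Γ.T → ¬ Γ.Linked (Γ.T.erase s(a, b)) a b

/-- The (connected) graph has `g` loops, i.e. first Betti number `|E| - |V| + 1 = g`. -/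
def HasLoopOrder (g : ℕ) : Prop := Γ.E.card + 1 = Γ.V.card + g

/-- A bridge is an edge, not incident to a hair vertex, whose removal disconnects the graph. -/
def IsBridge (e : Sym2 ℕ) : Prop :=
  e ∈ Γ.E ∧ (∀ i, Γ.hair i ∉ e) ∧ ¬ Γ.ConnectedBy (Γ.E.erase e)

/-- A graph is bridgeless if none of its edges is a bridge. -/
def Bridgeless : Prop := ∀ e, ¬ Γ.IsBridge e

/-- The vertex of `Γ / e` obtained by merging the endpoints of `e`. -/
def mergedVertex (e : Sym2 ℕ) : Finset ℕ :=
  ((Γ.V.filter (fun v => ¬ Disjoint v e.toFinset)).sup id) \ e.toFinset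

/-- The contraction `(Γ / e, T \ {e})` of the edge `e`. -/
def contract (e : Sym2 ℕ) : MarkedGraph r where
  V := insert (Γ.mergedVertex e) (Γ.V.filter (fun v => Disjoint v e.toFinset))
  E := Γ.E.erase e
  hair := Γ.hair
  T := Γ.T.erase e

/-- The graph `(Γ, T \ {e})`, in which the edge `e` is unmarked. -/
def unmark (e : Sym2 ℕ) : MarkedGraph r where
  V := Γ.V
  E := Γ.E
  hair := Γ.hair
  T := Γ.T.erase e

/-- Renaming of half-edges.  As any bijection between two finite sets of natural numbers extends to
a permutation of `ℕ`, two graphs are isomorphic (compatibly with the numbering of the hairs and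
the marking) if and only if they are related by such a renaming. -/
def relabel (σ : Equiv.Perm ℕ) : MarkedGraph r where
  V := Γ.V.image (fun v => v.image σ)
  E := Γ.E.image (Sym2.map σ)
  hair := σ ∘ Γ.hair
  T := Γ.T.image (Sym2.map σ)

end MarkedGraph

/-- The symbols that occur in orientations. -/
inductive Label where
  | half (h : ℕ)
  | vert (v : Finset ℕ)
  | edge (e : Sym2 ℕ)

/-- Renaming of half-edges in a symbol. -/
def Label.relabel (σ : Equiv.Perm ℕ) : Label → Label
  | .half h => .half (σ h)
  | .vert v => .vert (v.image σ)
  | .edge e => .edge (e.map σ)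

section Wedge

variable (R : Type u) [CommRing R]

/-- The exterior algebra in the symbols. -/
abbrev Wedge : Type u := ExteriorAlgebra R (Label →₀ R)

variable {R}

/-- The monomial `x₁ ∧ x₂ ∧ ⋯ ∧ xₖ`. -/
def monomial (l : List Label) : Wedge R :=
  (l.map fun x => ExteriorAlgebra.ι R (Finsupp.single x (1 : R))).prod

/-- Left multiplication `x ∧ -`. -/
def wedge (x : Label) : Wedge R →ₗ[R] Wedge R :=
  LinearMap.mulLeft R (ExteriorAlgebra.ι R (Finsupp.single x (1 : R)))

/-- The derivative `∂ₓ`, i.e. the odd derivation (from the left) with `∂ₓ x = 1` and `∂ₓ y = 0` for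
every symbol `y ≠ x`. -/
def der (x : Label) : Wedge R →ₗ[R] Wedge R :=
  CliffordAlgebra.contractLeft (Q := (0 : QuadraticForm R (Label →₀ R))) (Finsupp.lapply x)

/-- Renaming of half-edges in the exterior algebra. -/
def Wedge.relabel (σ : Equiv.Perm ℕ) : Wedge R →ₗ[R] Wedge R :=
  (ExteriorAlgebra.map (Finsupp.lmapDomain R R (Label.relabel σ))).toLinearMap

theorem der_wedge_self (x : Label) (ω : Wedge R) : der x (wedge x ω) = ω - wedge x (der x ω) := by
  have := CliffordAlgebra.contractLeft_ι_mul (Q := (0 : QuadraticForm R (Label →₀ R)))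
    (d := Finsupp.lapply x) (Finsupp.single x (1 : R)) ω
  simpa [der, wedge] using this

theorem der_wedge_ne {x y : Label} (h : x ≠ y) (ω : Wedge R) :
    der x (wedge y ω) = - wedge y (der x ω) := by
  have := CliffordAlgebra.contractLeft_ι_mul (Q := (0 : QuadraticForm R (Label →₀ R)))
    (d := Finsupp.lapply x) (Finsupp.single y (1 : R)) ω
  simpa [der, wedge, Finsupp.single_apply, h, h.symm] using this

theorem der_der (x y : Label) (ω : Wedge R) : der x (der y ω) = - der y (der x ω) :=
  CliffordAlgebra.contractLeft_comm (Q := (0 : QuadraticForm R (Label →₀ R))) (Finsupp.lapply x)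
    (d' := Finsupp.lapply y) ω

theorem wedge_wedge (x y : Label) (ω : Wedge R) :
    wedge x (wedge y ω) = - wedge y (wedge x ω) := by
  simp only [wedge, LinearMap.mulLeft_apply, ← mul_assoc]
  rw [← neg_mul, eq_neg_of_add_eq_zero_left (ExteriorAlgebra.ι_add_mul_swap _ _)]

theorem Label.relabel_injective (σ : Equiv.Perm ℕ) : Function.Injective (Label.relabel σ) := by
  intro x y h
  cases x <;> cases y <;> simp only [Label.relabel, Label.half.injEq, Label.vert.injEq,
    Label.edge.injEq, reduceCtorEq] at h ⊢
  · exact σ.injective h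
  · exact Finset.image_injective σ.injective h
  · exact Sym2.map.injective σ.injective h

theorem relabel_wedge (σ : Equiv.Perm ℕ) (x : Label) (ω : Wedge R) :
    Wedge.relabel σ (wedge x ω) = wedge (x.relabel σ) (Wedge.relabel σ ω) := by
  simp [Wedge.relabel, wedge]

theorem relabel_der (σ : Equiv.Perm ℕ) (x : Label) (ω : Wedge R) :
    Wedge.relabel σ (der x ω) = der (x.relabel σ) (Wedge.relabel σ ω) := by
  induction ω using CliffordAlgebra.left_induction with
  | algebraMap a =>
    simp only [der, CliffordAlgebra.contractLeft_algebraMap, map_zero]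
    have : Wedge.relabel σ (algebraMap R (CliffordAlgebra 0) a) = algebraMap R (Wedge R) a := by
      simp only [Wedge.relabel, AlgHom.toLinearMap_apply]
      exact AlgHom.commutes _ _
    rw [this]
    exact (CliffordAlgebra.contractLeft_algebraMap (Q := (0 : QuadraticForm R (Label →₀ R)))
      (Finsupp.lapply (x.relabel σ)) a).symm
  | add a b ha hb => simp only [map_add, ha, hb]
  | ι_mul a m ha =>
    have h1 : ∀ b : Wedge R, Wedge.relabel σ (ExteriorAlgebra.ι R m * b) =
        ExteriorAlgebra.ι R (Finsupp.mapDomain (Label.relabel σ) m) * Wedge.relabel σ b := by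
      intro b
      simp [Wedge.relabel]
    have h2 : ∀ (y : Label) (k : Label →₀ R) (b : Wedge R), der y (ExteriorAlgebra.ι R k * b) =
        k y • b - ExteriorAlgebra.ι R k * der y b := fun y k b =>
      CliffordAlgebra.contractLeft_ι_mul (Q := (0 : QuadraticForm R (Label →₀ R)))
        (d := Finsupp.lapply y) k b
    change Wedge.relabel σ (der x (ExteriorAlgebra.ι R m * a)) =
      der (x.relabel σ) (Wedge.relabel σ (ExteriorAlgebra.ι R m * a))
    rw [h1, h2, h2, map_sub, map_smul, h1, ha, Finsupp.mapDomain_apply (Label.relabel_injective σ)]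

/-- The linear combinations of orderings of the set `X` of symbols. -/
def orderings (R : Type u) [CommRing R] (X : Set Label) : Submodule R (Wedge R) :=
  Submodule.span R {ω | ∃ l : List Label, l.Nodup ∧ (∀ x, x ∈ l ↔ x ∈ X) ∧ ω = monomial l}

theorem monomial_cons (x : Label) (l : List Label) :
    (monomial (x :: l) : Wedge R) = wedge x (monomial l) := by
  simp [monomial, wedge]

theorem der_monomial_of_notMem {x : Label} {l : List Label} (h : x ∉ l) :
    der x (monomial l : Wedge R) = 0 := by
  induction l with
  | nil => exact CliffordAlgebra.contractLeft_one (Q := (0 : QuadraticForm R (Label →₀ R))) _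
  | cons y l ih =>
    simp only [List.mem_cons, not_or] at h
    rw [monomial_cons, der_wedge_ne h.1, ih h.2, map_zero, neg_zero]

theorem der_monomial_of_mem {x : Label} {l : List Label} (hl : l.Nodup) (h : x ∈ l) :
    ∃ l' : List Label, l'.Nodup ∧ (∀ y, y ∈ l' ↔ y ∈ l ∧ y ≠ x) ∧
      (der x (monomial l : Wedge R) = monomial l' ∨ der x (monomial l : Wedge R) = - monomial l') := by
  induction l with
  | nil => simp at h
  | cons y l ih =>
    rw [List.nodup_cons] at hl
    by_cases hxy : x = y
    · subst hxy
      refine ⟨l, hl.2, ?_, Or.inl ?_⟩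
      · intro y
        simp only [List.mem_cons]
        constructor
        · intro hy
          exact ⟨Or.inr hy, fun h => hl.1 (h ▸ hy)⟩
        · rintro ⟨h1 | h1, h2⟩
          · exact absurd h1 h2
          · exact h1
      · rw [monomial_cons, der_wedge_self, der_monomial_of_notMem hl.1, map_zero, sub_zero]
    · have hx : x ∈ l := by simpa [hxy] using h
      obtain ⟨l', h1, h2, h3⟩ := ih hl.2 hx
      refine ⟨y :: l', ?_, ?_, ?_⟩
      · rw [List.nodup_cons]
        exact ⟨fun h => hl.1 ((h2 y).1 h).1, h1⟩
      · intro z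
        simp only [List.mem_cons, h2]
        constructor
        · rintro (rfl | ⟨h, h'⟩)
          · exact ⟨Or.inl rfl, fun h => hxy h.symm⟩
          · exact ⟨Or.inr h, h'⟩
        · rintro ⟨h | h, h'⟩
          · exact Or.inl h
          · exact Or.inr ⟨h, h'⟩
      · rw [monomial_cons, monomial_cons, der_wedge_ne hxy]
        rcases h3 with h3 | h3
        · right; rw [h3]
        · left; rw [h3, map_neg, neg_neg]

theorem der_mem_orderings {X Y : Set Label} {x : Label} (hx : x ∈ X)
    (hY : ∀ y, y ∈ Y ↔ y ∈ X ∧ y ≠ x) {ω : Wedge R} (h : ω ∈ orderings R X) :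
    der x ω ∈ orderings R Y := by
  induction h using Submodule.span_induction with
  | mem ω h =>
    obtain ⟨l, h1, h2, rfl⟩ := h
    obtain ⟨l', h3, h4, h5⟩ := der_monomial_of_mem (R := R) h1 ((h2 x).2 hx)
    have : (monomial l' : Wedge R) ∈ orderings R Y :=
      Submodule.subset_span ⟨l', h3, fun y => by rw [h4, h2, hY], rfl⟩
    rcases h5 with h5 | h5
    · rwa [h5]
    · rw [h5]; exact neg_mem this
  | zero => simp
  | add a b _ _ ha hb => rw [map_add]; exact add_mem ha hb
  | smul c a _ ha => rw [map_smul]; exact Submodule.smul_mem _ _ ha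

theorem der_eq_zero {X : Set Label} {x : Label} (hx : x ∉ X) {ω : Wedge R}
    (h : ω ∈ orderings R X) : der x ω = 0 := by
  induction h using Submodule.span_induction with
  | mem ω h =>
    obtain ⟨l, h1, h2, rfl⟩ := h
    exact der_monomial_of_notMem (fun h => hx ((h2 x).1 h))
  | zero => simp
  | add a b _ _ ha hb => rw [map_add, ha, hb, add_zero]
  | smul c a _ ha => rw [map_smul, ha, smul_zero]

theorem wedge_mem_orderings {X Y : Set Label} {x : Label} (hx : x ∉ X)
    (hY : ∀ y, y ∈ Y ↔ y ∈ X ∨ y = x) {ω : Wedge R} (h : ω ∈ orderings R X) :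
    wedge x ω ∈ orderings R Y := by
  induction h using Submodule.span_induction with
  | mem ω h =>
    obtain ⟨l, h1, h2, rfl⟩ := h
    refine Submodule.subset_span ⟨x :: l, ?_, ?_, (monomial_cons x l).symm⟩
    · rw [List.nodup_cons]
      exact ⟨fun h => hx ((h2 x).1 h), h1⟩
    · intro y
      rw [hY, List.mem_cons, h2, or_comm]
  | zero => simp
  | add a b _ _ ha hb => rw [map_add]; exact add_mem ha hb
  | smul c a _ ha => rw [map_smul]; exact Submodule.smul_mem _ _ ha

end Wedge

namespace MarkedGraph

variable {r : ℕ}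

/-- The set that is ordered by an orientation: the marked edges if `n` is even; the internal
vertices, half-edges and unmarked edges if `n` is odd.  (For `n` odd, the hair edges and their
half-edges are included; as they are fixed by all isomorphisms and never contracted, leaving
them out would give an isomorphic complex.) -/
def orientationSet (n : ℤ) (Γ : MarkedGraph r) : Set Label :=
  if Even n then {x | ∃ e ∈ Γ.T, x = .edge e}
  else {x | (∃ v ∈ Γ.V, (∀ i, v ≠ {Γ.hair i}) ∧ x = .vert v) ∨ (∃ h ∈ Γ.H, x = .half h) ∨
    ∃ e ∈ Γ.E, e ∉ Γ.T ∧ x = .edge e}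

/-- `ω` is an orientation of `Γ`, i.e. an ordering of the relevant set written as a monomial in the
exterior algebra; so orderings are identified up to even permutations, and the opposite orientation
is `-ω`. -/
def IsOrientation {R : Type u} [CommRing R] (n : ℤ) (Γ : MarkedGraph r) (ω : Wedge R) : Prop :=
  ∃ l : List Label, l.Nodup ∧ (∀ x, x ∈ l ↔ x ∈ Γ.orientationSet n) ∧ ω = monomial l

variable (R : Type u) [CommRing R]

/-- The operation on orientations for the contraction of an edge `e = {h₁, h₂}` with endpoints `v₁`
and `v₂`: it is `∂ₑ` for `n` even, and `vₑ ∧ ∂_{v₁} ∂_{v₂} ∂_{h₁} ∂_{h₂}` for `n` odd, where `vₑ` is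
the new vertex. -/
def contractOrientation (n : ℤ) (Γ : MarkedGraph r) (e : Sym2 ℕ) : Wedge R →ₗ[R] Wedge R :=
  if Even n then der (.edge e)
  else wedge (.vert (Γ.mergedVertex e)) ∘ₗ
    Sym2.lift ⟨fun a b => der (.vert (Γ.vertexOf a)) ∘ₗ der (.vert (Γ.vertexOf b)) ∘ₗ
      der (.half a) ∘ₗ der (.half b), fun a b => by
        refine LinearMap.ext fun ω => ?_
        simp only [LinearMap.comp_apply]
        rw [der_der (.half a), map_neg, map_neg, der_der (.vert (Γ.vertexOf a)), neg_neg]⟩ e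

/-- The operation on orientations for the unmarking of an edge `e`: it is `∂ₑ` for `n` even and
`e ∧ -` for `n` odd. -/
def unmarkOrientation (n : ℤ) (e : Sym2 ℕ) : Wedge R →ₗ[R] Wedge R :=
  if Even n then der (.edge e) else wedge (.edge e)

end MarkedGraph

section Spaces

variable (R : Type u) [CommRing R] (n : ℤ) (r : ℕ)

/-- The relations identifying isomorphic oriented graphs. -/
def isoRelations : Submodule R (MarkedGraph r →₀ Wedge R) :=
  Submodule.span R {x | ∃ (Γ : MarkedGraph r) (σ : Equiv.Perm ℕ) (ω : Wedge R),
    x = Finsupp.single (Γ.relabel σ) (Wedge.relabel σ ω) - Finsupp.single Γ ω}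

/-- The ambient space of formal linear combinations of pairs `(Γ, ω)`, linear in `ω`, modulo
isomorphism.  No condition is imposed on `Γ` and `ω` here; the relations are homogeneous with
respect to the isomorphism class of `Γ` together with the set of symbols occurring in a monomial `ω`, so
that the span of the oriented admissible graphs in this space is the space of linear combinations
of oriented admissible graphs modulo isomorphism and `(Γ, -ω) = -(Γ, ω)`. -/
abbrev Ambient : Type u := (MarkedGraph r →₀ Wedge R) ⧸ isoRelations R r

variable {R r} in
/-- The class of the pair `(Γ, ω)`. -/
def cls (Γ : MarkedGraph r) : Wedge R →ₗ[R] Ambient R r :=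
  (isoRelations R r).mkQ ∘ₗ Finsupp.lsingle Γ

/-- The contraction differential, before passing to isomorphism classes. -/
def preContract : (MarkedGraph r →₀ Wedge R) →ₗ[R] (MarkedGraph r →₀ Wedge R) :=
  Finsupp.lsum R fun Γ => ∑ e ∈ Γ.T,
    Finsupp.lsingle (Γ.contract e) ∘ₗ Γ.contractOrientation R n e

/-- The unmarking differential, before passing to isomorphism classes. -/
def preUnmark : (MarkedGraph r →₀ Wedge R) →ₗ[R] (MarkedGraph r →₀ Wedge R) :=
  Finsupp.lsum R fun Γ => ∑ e ∈ Γ.T,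
    Finsupp.lsingle (Γ.unmark e) ∘ₗ MarkedGraph.unmarkOrientation R n e

variable {R n r}

theorem cls_relabel (σ : Equiv.Perm ℕ) (Γ : MarkedGraph r) (ω : Wedge R) :
    cls (Γ.relabel σ) (Wedge.relabel σ ω) = cls Γ ω :=
  (Submodule.Quotient.eq _).2 (Submodule.subset_span ⟨Γ, σ, ω, rfl⟩)

theorem toFinset_map (σ : Equiv.Perm ℕ) (e : Sym2 ℕ) :
    (e.map σ).toFinset = e.toFinset.image σ := by
  ext x
  simp [Sym2.mem_map]

theorem map_mem_map (σ : Equiv.Perm ℕ) (e : Sym2 ℕ) (x : ℕ) : σ x ∈ e.map σ ↔ x ∈ e := by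
  simp [Sym2.mem_map]

namespace MarkedGraph

theorem mem_mergedVertex (Γ : MarkedGraph r) (e : Sym2 ℕ) (x : ℕ) :
    x ∈ Γ.mergedVertex e ↔ (∃ v ∈ Γ.V, ¬ Disjoint v e.toFinset ∧ x ∈ v) ∧ x ∉ e := by
  simp [mergedVertex, Finset.mem_sup, and_assoc]

theorem mem_vertexOf (Γ : MarkedGraph r) (h x : ℕ) :
    x ∈ Γ.vertexOf h ↔ ∃ v ∈ Γ.V, h ∈ v ∧ x ∈ v := by
  simp [vertexOf, Finset.mem_sup, and_assoc]

theorem mergedVertex_relabel (σ : Equiv.Perm ℕ) (Γ : MarkedGraph r) (e : Sym2 ℕ) :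
    (Γ.relabel σ).mergedVertex (e.map σ) = (Γ.mergedVertex e).image σ := by
  ext x
  obtain ⟨x, rfl⟩ := σ.surjective x
  rw [mem_mergedVertex, σ.injective.mem_finset_image, mem_mergedVertex, map_mem_map, toFinset_map]
  simp only [relabel, Finset.exists_mem_image, Finset.disjoint_image σ.injective,
    σ.injective.mem_finset_image]

theorem vertexOf_relabel (σ : Equiv.Perm ℕ) (Γ : MarkedGraph r) (h : ℕ) :
    (Γ.relabel σ).vertexOf (σ h) = (Γ.vertexOf h).image σ := by
  ext x
  obtain ⟨x, rfl⟩ := σ.surjective x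
  rw [mem_vertexOf, σ.injective.mem_finset_image, mem_vertexOf]
  simp only [relabel, Finset.exists_mem_image, σ.injective.mem_finset_image]

theorem contract_relabel (σ : Equiv.Perm ℕ) (Γ : MarkedGraph r) (e : Sym2 ℕ) :
    (Γ.relabel σ).contract (e.map σ) = (Γ.contract e).relabel σ := by
  have h := Sym2.map.injective σ.injective
  ext1
  · simp only [contract]
    rw [mergedVertex_relabel, toFinset_map]
    simp only [relabel, Finset.image_insert, Finset.filter_image,
      Finset.disjoint_image σ.injective]
  · simp only [contract, relabel, Finset.image_erase h]
  · rfl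
  · simp only [contract, relabel, Finset.image_erase h]

theorem unmark_relabel (σ : Equiv.Perm ℕ) (Γ : MarkedGraph r) (e : Sym2 ℕ) :
    (Γ.relabel σ).unmark (e.map σ) = (Γ.unmark e).relabel σ := by
  ext1 <;> simp only [unmark, relabel, Finset.image_erase (Sym2.map.injective σ.injective)]

theorem contractOrientation_relabel (σ : Equiv.Perm ℕ) (Γ : MarkedGraph r) (e : Sym2 ℕ)
    (ω : Wedge R) : (Γ.relabel σ).contractOrientation R n (e.map σ) (Wedge.relabel σ ω) =
      Wedge.relabel σ (Γ.contractOrientation R n e ω) := by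
  unfold contractOrientation
  split_ifs
  · rw [relabel_der]; rfl
  · induction e using Sym2.ind with
    | _ a b =>
    have h := mergedVertex_relabel σ Γ s(a, b)
    simp only [Sym2.map_mk] at h
    simp only [Sym2.map_mk, Sym2.lift_mk, LinearMap.comp_apply, relabel_wedge, relabel_der,
      Label.relabel, h, vertexOf_relabel]

theorem unmarkOrientation_relabel (σ : Equiv.Perm ℕ) (e : Sym2 ℕ) (ω : Wedge R) :
    unmarkOrientation R n (e.map σ) (Wedge.relabel σ ω) =
      Wedge.relabel σ (unmarkOrientation R n e ω) := by
  unfold unmarkOrientation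
  split_ifs
  · rw [relabel_der]; rfl
  · rw [relabel_wedge]; rfl

end MarkedGraph

theorem preContract_single (Γ : MarkedGraph r) (ω : Wedge R) :
    (isoRelations R r).mkQ (preContract R n r (Finsupp.single Γ ω)) =
      ∑ e ∈ Γ.T, cls (Γ.contract e) (Γ.contractOrientation R n e ω) := by
  simp [preContract, cls]

theorem preUnmark_single (Γ : MarkedGraph r) (ω : Wedge R) :
    (isoRelations R r).mkQ (preUnmark R n r (Finsupp.single Γ ω)) =
      ∑ e ∈ Γ.T, cls (Γ.unmark e) (MarkedGraph.unmarkOrientation R n e ω) := by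
  simp [preUnmark, cls]

variable (R n r)

/-- The edge contraction differential
`d_c (γ, T, or) = ∑_{e ∈ T} (γ / e, T \ {e}, contractOrientation e or)`. -/
def dc : Ambient R r →ₗ[R] Ambient R r :=
  (isoRelations R r).liftQ ((isoRelations R r).mkQ ∘ₗ preContract R n r) <| by
    refine Submodule.span_le.2 ?_
    rintro _ ⟨Γ, σ, ω, rfl⟩
    rw [SetLike.mem_coe, LinearMap.mem_ker, LinearMap.comp_apply, map_sub, map_sub,
      preContract_single, preContract_single, sub_eq_zero]
    simp only [MarkedGraph.relabel]
    rw [Finset.sum_image (Sym2.map.injective σ.injective).injOn]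
    refine Finset.sum_congr rfl fun e _ => ?_
    have h1 := Γ.contract_relabel σ e
    have h2 := Γ.contractOrientation_relabel (n := n) σ e ω
    refine Eq.trans ?_ (cls_relabel σ _ _)
    rw [← h1, ← h2]
    rfl

/-- The unmarking differential
`d_u (γ, T, or) = ∑_{e ∈ T} (γ, T \ {e}, unmarkOrientation e or)`. -/
def du : Ambient R r →ₗ[R] Ambient R r :=
  (isoRelations R r).liftQ ((isoRelations R r).mkQ ∘ₗ preUnmark R n r) <| by
    refine Submodule.span_le.2 ?_
    rintro _ ⟨Γ, σ, ω, rfl⟩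
    rw [SetLike.mem_coe, LinearMap.mem_ker, LinearMap.comp_apply, map_sub, map_sub,
      preUnmark_single, preUnmark_single, sub_eq_zero]
    simp only [MarkedGraph.relabel]
    rw [Finset.sum_image (Sym2.map.injective σ.injective).injOn]
    refine Finset.sum_congr rfl fun e _ => ?_
    have h1 := Γ.unmark_relabel σ e
    have h2 := MarkedGraph.unmarkOrientation_relabel (R := R) (n := n) σ e ω
    refine Eq.trans ?_ (cls_relabel σ _ _)
    rw [← h1, ← h2]
    rfl

variable {R n r}

theorem dc_cls (Γ : MarkedGraph r) (ω : Wedge R) : dc R n r (cls Γ ω) =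
    ∑ e ∈ Γ.T, cls (Γ.contract e) (Γ.contractOrientation R n e ω) :=
  preContract_single Γ ω

theorem du_cls (Γ : MarkedGraph r) (ω : Wedge R) : du R n r (cls Γ ω) =
    ∑ e ∈ Γ.T, cls (Γ.unmark e) (MarkedGraph.unmarkOrientation R n e ω) :=
  preUnmark_single Γ ω

namespace MarkedGraph

variable {Γ : MarkedGraph r}

theorem mem_H {h : ℕ} : h ∈ Γ.H ↔ ∃ v ∈ Γ.V, h ∈ v := by
  simp [H, Finset.mem_sup]

theorem Linked.lift {Γ' : MarkedGraph r} {S S' : Finset (Sym2 ℕ)} (ρ : ℕ → ℕ)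
    (h1 : ∀ v ∈ Γ.V, ∀ a ∈ v, ∀ b ∈ v, Γ'.Linked S' (ρ a) (ρ b))
    (h2 : ∀ a b, s(a, b) ∈ S → Γ'.Linked S' (ρ a) (ρ b)) {x y : ℕ} (h : Γ.Linked S x y) :
    Γ'.Linked S' (ρ x) (ρ y) := by
  induction h with
  | rel a b hab =>
    rcases hab with ⟨v, hv, ha, hb⟩ | hab
    · exact h1 v hv a ha b hb
    · exact h2 a b hab
  | refl a => exact Relation.EqvGen.refl _
  | symm a b _ ih => exact Relation.EqvGen.symm _ _ ih
  | trans a b c _ _ ih1 ih2 => exact Relation.EqvGen.trans _ _ _ ih1 ih2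

theorem Linked.vertex {S : Finset (Sym2 ℕ)} {v : Finset ℕ} (hv : v ∈ Γ.V) {a b : ℕ} (ha : a ∈ v)
    (hb : b ∈ v) : Γ.Linked S a b := Relation.EqvGen.rel _ _ (Or.inl ⟨v, hv, ha, hb⟩)

theorem Linked.edge {S : Finset (Sym2 ℕ)} {a b : ℕ} (h : s(a, b) ∈ S) : Γ.Linked S a b :=
  Relation.EqvGen.rel _ _ (Or.inr h)

theorem Linked.mono {S S' : Finset (Sym2 ℕ)} (h : S ⊆ S') {x y : ℕ} (hl : Γ.Linked S x y) :
    Γ.Linked S' x y :=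
  Linked.lift id (fun _ hv _ ha _ hb => Linked.vertex hv ha hb) (fun _ _ hab => Linked.edge (h hab))
    hl

namespace Admissible

theorem vertexOf_eq (hΓ : Γ.Admissible) {h : ℕ} {v : Finset ℕ} (hv : v ∈ Γ.V) (hh : h ∈ v) :
    Γ.vertexOf h = v := by
  ext x
  rw [mem_vertexOf]
  constructor
  · rintro ⟨w, hw, h1, h2⟩
    rwa [hΓ.disjoint v hv w hw h hh h1]
  · exact fun hx => ⟨v, hv, hh, hx⟩

theorem edge_eq (hΓ : Γ.Admissible) {e f : Sym2 ℕ} (he : e ∈ Γ.E) (hf : f ∈ Γ.E) {h : ℕ}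
    (h1 : h ∈ e) (h2 : h ∈ f) : e = f :=
  (hΓ.edge_unique h (hΓ.edge_mem e he h h1)).unique ⟨he, h1⟩ ⟨hf, h2⟩

end Admissible

/-- The local situation at a marked edge `s(a, b)`, with endpoints `v` and `w`. -/
structure EdgeAt (Γ : MarkedGraph r) (a b : ℕ) (v w : Finset ℕ) : Prop where
  mem_T : s(a, b) ∈ Γ.T
  mem_E : s(a, b) ∈ Γ.E
  v_mem : v ∈ Γ.V
  w_mem : w ∈ Γ.V
  a_mem : a ∈ v
  b_mem : b ∈ w
  v_ne_w : v ≠ w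
  a_ne_b : a ≠ b
  v_int : ∀ i, v ≠ {Γ.hair i}
  w_int : ∀ i, w ≠ {Γ.hair i}

theorem EdgeAt.symm {a b : ℕ} {v w : Finset ℕ} (h : Γ.EdgeAt a b v w) : Γ.EdgeAt b a w v :=
  ⟨Sym2.eq_swap ▸ h.mem_T, Sym2.eq_swap ▸ h.mem_E, h.w_mem, h.v_mem, h.b_mem, h.a_mem, h.v_ne_w.symm,
    h.a_ne_b.symm, h.w_int, h.v_int⟩

theorem Admissible.edgeAt (hΓ : Γ.Admissible) {a b : ℕ} (he : s(a, b) ∈ Γ.T) :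
    ∃ v w, Γ.EdgeAt a b v w := by
  have hE := hΓ.marked_subset he
  obtain ⟨v, hv, ha⟩ := mem_H.1 (hΓ.edge_mem _ hE a (Sym2.mem_mk_left a b))
  obtain ⟨w, hw, hb⟩ := mem_H.1 (hΓ.edge_mem _ hE b (Sym2.mem_mk_right a b))
  refine ⟨v, w, he, hE, hv, hw, ha, hb, ?_, ?_, ?_, ?_⟩
  · rintro rfl
    exact hΓ.forest a b he (Linked.vertex hv ha hb)
  · exact fun h => hΓ.edge_ne _ hE (Sym2.mk_isDiag_iff.2 h)
  · rintro i rfl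
    rw [Finset.mem_singleton] at ha
    exact hΓ.marked_hair _ he i (ha ▸ Sym2.mem_mk_left a b)
  · rintro i rfl
    rw [Finset.mem_singleton] at hb
    exact hΓ.marked_hair _ he i (hb ▸ Sym2.mem_mk_right a b)

namespace EdgeAt

variable {a b : ℕ} {v w : Finset ℕ}

theorem disjoint_iff (h : Γ.EdgeAt a b v w) (hΓ : Γ.Admissible) {u : Finset ℕ} (hu : u ∈ Γ.V) :
    Disjoint u s(a, b).toFinset ↔ u ≠ v ∧ u ≠ w := by
  rw [Sym2.toFinset_mk_eq, Finset.disjoint_insert_right, Finset.disjoint_singleton_right]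
  constructor
  · rintro ⟨h1, h2⟩
    exact ⟨fun h3 => h1 (h3 ▸ h.a_mem), fun h3 => h2 (h3 ▸ h.b_mem)⟩
  · rintro ⟨h1, h2⟩
    exact ⟨fun h3 => h1 (hΓ.disjoint _ hu _ h.v_mem _ h3 h.a_mem),
      fun h3 => h2 (hΓ.disjoint _ hu _ h.w_mem _ h3 h.b_mem)⟩

theorem merged_eq (h : Γ.EdgeAt a b v w) (hΓ : Γ.Admissible) :
    Γ.mergedVertex s(a, b) = (v ∪ w) \ {a, b} := by
  ext x
  rw [mem_mergedVertex]
  simp only [Sym2.mem_iff, Finset.mem_sdiff, Finset.mem_union, Finset.mem_insert,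
    Finset.mem_singleton]
  refine and_congr_left fun _ => ?_
  constructor
  · rintro ⟨u, hu, h1, h2⟩
    rw [h.disjoint_iff hΓ hu, not_and_or, not_not, not_not] at h1
    rcases h1 with rfl | rfl
    · exact Or.inl h2
    · exact Or.inr h2
  · rintro (hx | hx)
    · exact ⟨v, h.v_mem, by simp [h.disjoint_iff hΓ h.v_mem], hx⟩
    · exact ⟨w, h.w_mem, by simp [h.disjoint_iff hΓ h.w_mem], hx⟩

theorem mem_merged (h : Γ.EdgeAt a b v w) (hΓ : Γ.Admissible) {x : ℕ} :
    x ∈ Γ.mergedVertex s(a, b) ↔ (x ∈ v ∨ x ∈ w) ∧ x ≠ a ∧ x ≠ b := by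
  simp [h.merged_eq hΓ]

theorem mem_V (h : Γ.EdgeAt a b v w) (hΓ : Γ.Admissible) {u : Finset ℕ} :
    u ∈ (Γ.contract s(a, b)).V ↔
      u = Γ.mergedVertex s(a, b) ∨ u ∈ Γ.V ∧ u ≠ v ∧ u ≠ w := by
  simp only [contract, Finset.mem_insert, Finset.mem_filter]
  refine or_congr_right (and_congr_right fun hu => ?_)
  exact h.disjoint_iff hΓ hu

theorem card_merged (h : Γ.EdgeAt a b v w) (hΓ : Γ.Admissible) :
    (Γ.mergedVertex s(a, b)).card + 2 = v.card + w.card := by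
  rw [h.merged_eq hΓ, ← Finset.card_union_of_disjoint, ← Finset.card_pair h.a_ne_b]
  · refine Finset.card_sdiff_add_card_eq_card ?_
    intro x hx
    rw [Finset.mem_insert, Finset.mem_singleton] at hx
    rcases hx with rfl | rfl
    · exact Finset.mem_union_left _ h.a_mem
    · exact Finset.mem_union_right _ h.b_mem
  · rw [Finset.disjoint_left]
    exact fun x h1 h2 => h.v_ne_w (hΓ.disjoint _ h.v_mem _ h.w_mem x h1 h2)

theorem merged_card_ge (h : Γ.EdgeAt a b v w) (hΓ : Γ.Admissible) :
    4 ≤ (Γ.mergedVertex s(a, b)).card := by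
  have h1 := h.card_merged hΓ
  have h2 := hΓ.valence v h.v_mem h.v_int
  have h3 := hΓ.valence w h.w_mem h.w_int
  omega

theorem merged_nonempty (h : Γ.EdgeAt a b v w) (hΓ : Γ.Admissible) :
    (Γ.mergedVertex s(a, b)).Nonempty := by
  rw [← Finset.card_pos]
  have := h.merged_card_ge hΓ
  omega

theorem not_mem_merged (h : Γ.EdgeAt a b v w) (hΓ : Γ.Admissible) {u : Finset ℕ} (hu : u ∈ Γ.V)
    (hv : u ≠ v) (hw : u ≠ w) {x : ℕ} (hx : x ∈ u) : x ∉ Γ.mergedVertex s(a, b) := by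
  rw [h.mem_merged hΓ]
  rintro ⟨h1 | h1, -⟩
  · exact hv (hΓ.disjoint _ hu _ h.v_mem x hx h1)
  · exact hw (hΓ.disjoint _ hu _ h.w_mem x hx h1)

theorem merged_not_mem (h : Γ.EdgeAt a b v w) (hΓ : Γ.Admissible) :
    Γ.mergedVertex s(a, b) ∉ Γ.V := by
  intro hm
  obtain ⟨x, hx⟩ := h.merged_nonempty hΓ
  have h1 := (h.mem_merged hΓ).1 hx
  by_cases hv : Γ.mergedVertex s(a, b) = v
  · have := h.a_mem
    rw [← hv, h.mem_merged hΓ] at this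
    exact this.2.1 rfl
  by_cases hw : Γ.mergedVertex s(a, b) = w
  · have := h.b_mem
    rw [← hw, h.mem_merged hΓ] at this
    exact this.2.2 rfl
  exact h.not_mem_merged hΓ hm hv hw hx hx

theorem mem_H (h : Γ.EdgeAt a b v w) (hΓ : Γ.Admissible) {x : ℕ} :
    x ∈ (Γ.contract s(a, b)).H ↔ x ∈ Γ.H ∧ x ≠ a ∧ x ≠ b := by
  simp only [MarkedGraph.mem_H]
  constructor
  · rintro ⟨u, hu, hx⟩
    rcases (h.mem_V hΓ).1 hu with rfl | ⟨h1, h2, h3⟩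
    · rw [h.mem_merged hΓ] at hx
      refine ⟨?_, hx.2⟩
      rcases hx.1 with h1 | h1
      · exact ⟨v, h.v_mem, h1⟩
      · exact ⟨w, h.w_mem, h1⟩
    · refine ⟨⟨u, h1, hx⟩, ?_, ?_⟩
      · rintro rfl
        exact h2 (hΓ.disjoint _ h1 _ h.v_mem _ hx h.a_mem)
      · rintro rfl
        exact h3 (hΓ.disjoint _ h1 _ h.w_mem _ hx h.b_mem)
  · rintro ⟨⟨u, hu, hx⟩, h2⟩
    by_cases hv : u = v
    · exact ⟨_, (h.mem_V hΓ).2 (Or.inl rfl), (h.mem_merged hΓ).2 ⟨Or.inl (hv ▸ hx), h2⟩⟩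
    by_cases hw : u = w
    · exact ⟨_, (h.mem_V hΓ).2 (Or.inl rfl), (h.mem_merged hΓ).2 ⟨Or.inr (hw ▸ hx), h2⟩⟩
    exact ⟨u, (h.mem_V hΓ).2 (Or.inr ⟨hu, hv, hw⟩), hx⟩

/-- Paths in the contracted graph come from paths in the original graph. -/
theorem linked_of_contract (h : Γ.EdgeAt a b v w) (hΓ : Γ.Admissible) {S S' : Finset (Sym2 ℕ)}
    (hS : S ⊆ S') (he : s(a, b) ∈ S') {x y : ℕ} (hl : (Γ.contract s(a, b)).Linked S x y) :
    Γ.Linked S' x y := by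
  refine Linked.lift id ?_ (fun c d hcd => Linked.edge (hS hcd)) hl
  intro u hu c hc d hd
  rcases (h.mem_V hΓ).1 hu with rfl | ⟨h1, -, -⟩
  · have key : ∀ c ∈ Γ.mergedVertex s(a, b), Γ.Linked S' c a := by
      intro c hc
      rcases ((h.mem_merged hΓ).1 hc).1 with h1 | h1
      · exact Linked.vertex h.v_mem h1 h.a_mem
      · exact Relation.EqvGen.trans _ b _ (Linked.vertex h.w_mem h1 h.b_mem)
          (Relation.EqvGen.symm _ _ (Linked.edge he))
    exact Relation.EqvGen.trans _ a _ (key c hc) (Relation.EqvGen.symm _ _ (key d hd))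
  · exact Linked.vertex h1 hc hd

/-- Paths in the original graph induce paths in the contracted graph. -/
theorem linked_contract (h : Γ.EdgeAt a b v w) (hΓ : Γ.Admissible) {S S' : Finset (Sym2 ℕ)}
    (hS : S ⊆ Γ.E) (hS' : S.erase s(a, b) ⊆ S') {x y : ℕ} (hx : x ≠ a ∧ x ≠ b) (hy : y ≠ a ∧ y ≠ b)
    (hl : Γ.Linked S x y) : (Γ.contract s(a, b)).Linked S' x y := by
  obtain ⟨c, hc⟩ := h.merged_nonempty hΓ
  have hm := (h.mem_V hΓ).2 (Or.inl rfl)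
  let ρ : ℕ → ℕ := fun x => if x = a ∨ x = b then c else x
  have hρ : ∀ x, x ≠ a ∧ x ≠ b → ρ x = x := fun x hx => by simp [ρ, hx.1, hx.2]
  rw [← hρ x hx, ← hρ y hy]
  refine Linked.lift ρ ?_ ?_ hl
  · intro u hu p hp q hq
    by_cases huv : u = v ∨ u = w
    · have key : ∀ p ∈ u, ρ p ∈ Γ.mergedVertex s(a, b) := by
        intro p hp
        by_cases hpa : p = a ∨ p = b
        · simpa [ρ, hpa] using hc
        · rw [not_or] at hpa
          rw [hρ p hpa, h.mem_merged hΓ]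
          refine ⟨?_, hpa⟩
          rcases huv with rfl | rfl
          · exact Or.inl hp
          · exact Or.inr hp
      exact Linked.vertex hm (key p hp) (key q hq)
    · rw [not_or] at huv
      have key : ∀ p ∈ u, ρ p = p := by
        intro p hp
        refine hρ p ⟨?_, ?_⟩
        · rintro rfl
          exact huv.1 (hΓ.disjoint _ hu _ h.v_mem _ hp h.a_mem)
        · rintro rfl
          exact huv.2 (hΓ.disjoint _ hu _ h.w_mem _ hp h.b_mem)
      rw [key p hp, key q hq]
      exact Linked.vertex ((h.mem_V hΓ).2 (Or.inr ⟨hu, huv⟩)) hp hq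
  · intro p q hpq
    by_cases hE : s(p, q) = s(a, b)
    · have h1 : p = a ∨ p = b := by
        rw [← Sym2.mem_iff, ← hE]; exact Sym2.mem_mk_left _ _
      have h2 : q = a ∨ q = b := by
        rw [← Sym2.mem_iff, ← hE]; exact Sym2.mem_mk_right _ _
      simp only [ρ, h1, h2, if_true]
      exact Relation.EqvGen.refl _
    · have key : ∀ p' ∈ s(p, q), ρ p' = p' := by
        intro p' hp'
        refine hρ p' ⟨?_, ?_⟩
        · rintro rfl
          exact hE (hΓ.edge_eq (hS hpq) h.mem_E hp' (Sym2.mem_mk_left _ _))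
        · rintro rfl
          exact hE (hΓ.edge_eq (hS hpq) h.mem_E hp' (Sym2.mem_mk_right _ _))
      rw [key p (Sym2.mem_mk_left _ _), key q (Sym2.mem_mk_right _ _)]
      exact Linked.edge (hS' (Finset.mem_erase.2 ⟨hE, hpq⟩))

theorem connected_contract (h : Γ.EdgeAt a b v w) (hΓ : Γ.Admissible) {S S' : Finset (Sym2 ℕ)}
    (hS : S ⊆ Γ.E) (hS' : S.erase s(a, b) ⊆ S') (hc : Γ.ConnectedBy S) :
    (Γ.contract s(a, b)).ConnectedBy S' := by
  constructor
  · obtain ⟨c, hc⟩ := h.merged_nonempty hΓ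
    exact ⟨c, MarkedGraph.mem_H.2 ⟨_, (h.mem_V hΓ).2 (Or.inl rfl), hc⟩⟩
  · intro x hx y hy
    rw [h.mem_H hΓ] at hx hy
    exact h.linked_contract hΓ hS hS' hx.2 hy.2 (hc.2 x hx.1 y hy.1)

theorem admissible_contract (h : Γ.EdgeAt a b v w) (hΓ : Γ.Admissible) :
    (Γ.contract s(a, b)).Admissible where
  disjoint := by
    intro u hu u' hu' x hx hx'
    rcases (h.mem_V hΓ).1 hu with rfl | ⟨h1, h2, h3⟩ <;>
    rcases (h.mem_V hΓ).1 hu' with rfl | ⟨h1', h2', h3'⟩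
    · rfl
    · exact absurd hx (h.not_mem_merged hΓ h1' h2' h3' hx')
    · exact absurd hx' (h.not_mem_merged hΓ h1 h2 h3 hx)
    · exact hΓ.disjoint _ h1 _ h1' x hx hx'
  edge_ne := fun e he => hΓ.edge_ne e (Finset.mem_of_mem_erase he)
  edge_mem := by
    intro e he x hx
    have he' := Finset.mem_erase.1 he
    refine (h.mem_H hΓ).2 ⟨hΓ.edge_mem e he'.2 x hx, ?_, ?_⟩
    · rintro rfl
      exact he'.1 (hΓ.edge_eq he'.2 h.mem_E hx (Sym2.mem_mk_left _ _))
    · rintro rfl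
      exact he'.1 (hΓ.edge_eq he'.2 h.mem_E hx (Sym2.mem_mk_right _ _))
  edge_unique := by
    intro x hx
    rw [h.mem_H hΓ] at hx
    obtain ⟨e, ⟨he, hxe⟩, hu⟩ := hΓ.edge_unique x hx.1
    refine ⟨e, ⟨Finset.mem_erase.2 ⟨?_, he⟩, hxe⟩, fun f hf => hu f ⟨Finset.mem_of_mem_erase hf.1, hf.2⟩⟩
    rintro rfl
    rcases Sym2.mem_iff.1 hxe with h1 | h1
    · exact hx.2.1 h1
    · exact hx.2.2 h1
  hair_injective := hΓ.hair_injective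
  hair_mem := fun i => (h.mem_V hΓ).2
    (Or.inr ⟨hΓ.hair_mem i, fun h1 => h.v_int i h1.symm, fun h1 => h.w_int i h1.symm⟩)
  valence := by
    intro u hu hi
    rcases (h.mem_V hΓ).1 hu with rfl | ⟨h1, -, -⟩
    · have := h.merged_card_ge hΓ
      omega
    · exact hΓ.valence u h1 hi
  connected := h.connected_contract hΓ (Finset.Subset.refl _) (Finset.Subset.refl _) hΓ.connected
  marked_subset := Finset.erase_subset_erase _ hΓ.marked_subset
  marked_hair := fun e he => hΓ.marked_hair e (Finset.mem_of_mem_erase he)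
  forest := by
    intro c d hcd hl
    have hcd' := Finset.mem_erase.1 hcd
    refine hΓ.forest c d hcd'.2 (h.linked_of_contract hΓ ?_ ?_ hl)
    · exact Finset.erase_subset_erase _ (Finset.erase_subset _ _)
    · exact Finset.mem_erase.2 ⟨hcd'.1.symm, h.mem_T⟩

theorem loopOrder_contract (h : Γ.EdgeAt a b v w) (hΓ : Γ.Admissible) {g : ℕ}
    (hg : Γ.HasLoopOrder g) : (Γ.contract s(a, b)).HasLoopOrder g := by
  unfold HasLoopOrder at *
  have h1 : (Γ.contract s(a, b)).E.card + 1 = Γ.E.card := Finset.card_erase_add_one h.mem_E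
  have h2 : (Γ.contract s(a, b)).V.card + 1 = Γ.V.card := by
    have : (Γ.contract s(a, b)).V =
        insert (Γ.mergedVertex s(a, b)) ((Γ.V.erase v).erase w) := by
      ext u
      rw [h.mem_V hΓ, Finset.mem_insert, Finset.mem_erase, Finset.mem_erase]
      tauto
    have hw : w ∈ Γ.V.erase v := Finset.mem_erase.2 ⟨h.v_ne_w.symm, h.w_mem⟩
    rw [this, Finset.card_insert_of_notMem, Finset.card_erase_add_one hw,
      Finset.card_erase_add_one h.v_mem]
    exact fun hm => h.merged_not_mem hΓ (Finset.mem_of_mem_erase (Finset.mem_of_mem_erase hm))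
  omega

theorem bridgeless_contract (h : Γ.EdgeAt a b v w) (hΓ : Γ.Admissible) (hb : Γ.Bridgeless) :
    (Γ.contract s(a, b)).Bridgeless := by
  rintro e ⟨he, hi, hc⟩
  have he' := Finset.mem_erase.1 he
  refine hb e ⟨he'.2, hi, fun hc' => hc ?_⟩
  refine h.connected_contract hΓ (Finset.erase_subset _ _) ?_ hc'
  rw [Finset.erase_right_comm]
  exact Finset.Subset.refl _

end EdgeAt

theorem Admissible.unmark (hΓ : Γ.Admissible) (e : Sym2 ℕ) : (Γ.unmark e).Admissible where
  disjoint := hΓ.disjoint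
  edge_ne := hΓ.edge_ne
  edge_mem := hΓ.edge_mem
  edge_unique := hΓ.edge_unique
  hair_injective := hΓ.hair_injective
  hair_mem := hΓ.hair_mem
  valence := hΓ.valence
  connected := hΓ.connected
  marked_subset := (Finset.erase_subset _ _).trans hΓ.marked_subset
  marked_hair := fun f hf => hΓ.marked_hair f (Finset.mem_of_mem_erase hf)
  forest := fun a b hab hl => hΓ.forest a b (Finset.mem_of_mem_erase hab)
    (Linked.mono (Finset.erase_subset_erase _ (Finset.erase_subset _ _)) hl)

theorem bridgeless_unmark (h : Γ.Bridgeless) (e : Sym2 ℕ) : (Γ.unmark e).Bridgeless := h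

end MarkedGraph

namespace MarkedGraph

variable {Γ : MarkedGraph r}

theorem Admissible.edgeAt_of_mem (hΓ : Γ.Admissible) {a b : ℕ} {v w : Finset ℕ}
    (he : s(a, b) ∈ Γ.T) (hv : v ∈ Γ.V) (ha : a ∈ v) (hw : w ∈ Γ.V) (hb : b ∈ w) :
    Γ.EdgeAt a b v w := by
  obtain ⟨v', w', h⟩ := hΓ.edgeAt he
  rwa [hΓ.disjoint v hv v' h.v_mem a ha h.a_mem, hΓ.disjoint w hw w' h.w_mem b hb h.b_mem]

theorem EdgeAt.half_ne (hΓ : Γ.Admissible) {a b c d : ℕ} {v w x y : Finset ℕ}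
    (h : Γ.EdgeAt a b v w) (k : Γ.EdgeAt c d x y) (hne : s(a, b) ≠ s(c, d)) :
    c ≠ a ∧ c ≠ b ∧ d ≠ a ∧ d ≠ b := by
  refine ⟨?_, ?_, ?_, ?_⟩ <;> rintro rfl
  · exact hne (hΓ.edge_eq h.mem_E k.mem_E (Sym2.mem_mk_left _ _) (Sym2.mem_mk_left _ _))
  · exact hne (hΓ.edge_eq h.mem_E k.mem_E (Sym2.mem_mk_right _ _) (Sym2.mem_mk_left _ _))
  · exact hne (hΓ.edge_eq h.mem_E k.mem_E (Sym2.mem_mk_left _ _) (Sym2.mem_mk_right _ _))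
  · exact hne (hΓ.edge_eq h.mem_E k.mem_E (Sym2.mem_mk_right _ _) (Sym2.mem_mk_right _ _))

/-- Two marked edges without a common endpoint. -/
structure FarEdges (Γ : MarkedGraph r) (a b c d : ℕ) (v w x y : Finset ℕ) : Prop where
  left : Γ.EdgeAt a b v w
  right : Γ.EdgeAt c d x y
  ne : s(a, b) ≠ s(c, d)
  xv : x ≠ v
  xw : x ≠ w
  yv : y ≠ v
  yw : y ≠ w

/-- Two marked edges with a common endpoint `w`. -/
structure NearEdges (Γ : MarkedGraph r) (a b c d : ℕ) (v w x : Finset ℕ) : Prop where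
  left : Γ.EdgeAt a b v w
  right : Γ.EdgeAt c d w x
  ne : s(a, b) ≠ s(c, d)
  xv : x ≠ v

variable {a b c d : ℕ} {v w x y : Finset ℕ}

theorem FarEdges.symm (h : Γ.FarEdges a b c d v w x y) : Γ.FarEdges c d a b x y v w :=
  ⟨h.right, h.left, h.ne.symm, h.xv.symm, h.yv.symm, h.xw.symm, h.yw.symm⟩

theorem NearEdges.symm (h : Γ.NearEdges a b c d v w x) : Γ.NearEdges d c b a x w v :=
  ⟨h.right.symm, h.left.symm, by rw [Sym2.eq_swap, Sym2.eq_swap (a := b)]; exact h.ne.symm,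
    h.xv.symm⟩

theorem Admissible.far_or_near (hΓ : Γ.Admissible) {e f : Sym2 ℕ} (he : e ∈ Γ.T) (hf : f ∈ Γ.T)
    (hne : e ≠ f) : (∃ a b c d v w x y, e = s(a, b) ∧ f = s(c, d) ∧ Γ.FarEdges a b c d v w x y) ∨
      ∃ a b c d v w x, e = s(a, b) ∧ f = s(c, d) ∧ Γ.NearEdges a b c d v w x := by
  have aux : ∀ {a b c d : ℕ} {v w x : Finset ℕ}, Γ.EdgeAt a b v w → Γ.EdgeAt c d w x →
      s(a, b) ≠ s(c, d) → Γ.NearEdges a b c d v w x := by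
    intro a b c d v w x h k hne
    refine ⟨h, k, hne, ?_⟩
    rintro rfl
    refine hΓ.forest a b h.mem_T ?_
    refine Relation.EqvGen.trans _ d _ (Linked.vertex h.v_mem h.a_mem k.b_mem) ?_
    refine Relation.EqvGen.trans _ c _ (Relation.EqvGen.symm _ _ (Linked.edge ?_))
      (Linked.vertex h.w_mem k.a_mem h.b_mem)
    exact Finset.mem_erase.2 ⟨hne.symm, k.mem_T⟩
  induction e using Sym2.ind with | _ a b => ?_
  induction f using Sym2.ind with | _ c d => ?_
  obtain ⟨v, w, h⟩ := hΓ.edgeAt he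
  obtain ⟨x, y, k⟩ := hΓ.edgeAt hf
  by_cases h1 : x = w
  · subst h1
    exact Or.inr ⟨a, b, c, d, v, x, y, rfl, rfl, aux h k hne⟩
  by_cases h2 : x = v
  · subst h2
    exact Or.inr ⟨b, a, c, d, w, x, y, Sym2.eq_swap, rfl,
      aux h.symm k (by rwa [Sym2.eq_swap])⟩
  by_cases h3 : y = w
  · subst h3
    exact Or.inr ⟨a, b, d, c, v, y, x, rfl, Sym2.eq_swap,
      aux h k.symm (by rwa [Sym2.eq_swap (a := d)])⟩
  by_cases h4 : y = v
  · subst h4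
    exact Or.inr ⟨b, a, d, c, w, y, x, Sym2.eq_swap, Sym2.eq_swap,
      aux h.symm k.symm (by rwa [Sym2.eq_swap, Sym2.eq_swap (a := d)])⟩
  exact Or.inl ⟨a, b, c, d, v, w, x, y, rfl, rfl, h, k, hne, h2, h1, h4, h3⟩

theorem FarEdges.contract_right (h : Γ.FarEdges a b c d v w x y) (hΓ : Γ.Admissible) :
    (Γ.contract s(a, b)).EdgeAt c d x y :=
  (h.left.admissible_contract hΓ).edgeAt_of_mem (Finset.mem_erase.2 ⟨h.ne.symm, h.right.mem_T⟩)
    ((h.left.mem_V hΓ).2 (Or.inr ⟨h.right.v_mem, h.xv, h.xw⟩)) h.right.a_mem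
    ((h.left.mem_V hΓ).2 (Or.inr ⟨h.right.w_mem, h.yv, h.yw⟩)) h.right.b_mem

theorem NearEdges.contract_right (h : Γ.NearEdges a b c d v w x) (hΓ : Γ.Admissible) :
    (Γ.contract s(a, b)).EdgeAt c d (Γ.mergedVertex s(a, b)) x := by
  have hne := EdgeAt.half_ne hΓ h.left h.right h.ne
  exact (h.left.admissible_contract hΓ).edgeAt_of_mem
    (Finset.mem_erase.2 ⟨h.ne.symm, h.right.mem_T⟩)
    ((h.left.mem_V hΓ).2 (Or.inl rfl))
    ((h.left.mem_merged hΓ).2 ⟨Or.inr h.right.a_mem, hne.1, hne.2.1⟩)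
    ((h.left.mem_V hΓ).2 (Or.inr ⟨h.right.w_mem, h.xv, h.right.v_ne_w.symm⟩)) h.right.b_mem

theorem NearEdges.contract_left (h : Γ.NearEdges a b c d v w x) (hΓ : Γ.Admissible) :
    (Γ.contract s(c, d)).EdgeAt a b v (Γ.mergedVertex s(c, d)) := by
  have := h.symm.contract_right hΓ
  rw [Sym2.eq_swap (a := d)] at this
  exact this.symm

theorem FarEdges.merged_eq (h : Γ.FarEdges a b c d v w x y) (hΓ : Γ.Admissible) :
    (Γ.contract s(a, b)).mergedVertex s(c, d) = Γ.mergedVertex s(c, d) := by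
  rw [(h.contract_right hΓ).merged_eq (h.left.admissible_contract hΓ), h.right.merged_eq hΓ]

theorem NearEdges.merged_eq (h : Γ.NearEdges a b c d v w x) (hΓ : Γ.Admissible) :
    (Γ.contract s(a, b)).mergedVertex s(c, d) = (Γ.contract s(c, d)).mergedVertex s(a, b) := by
  ext z
  rw [(h.contract_right hΓ).mem_merged (h.left.admissible_contract hΓ),
    (h.contract_left hΓ).mem_merged (h.right.admissible_contract hΓ),
    h.left.mem_merged hΓ, h.right.mem_merged hΓ]
  have h1 : ∀ z ∈ x, z ≠ a ∧ z ≠ b := by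
    intro z hz
    constructor
    · rintro rfl
      exact h.xv (hΓ.disjoint _ h.right.w_mem _ h.left.v_mem _ hz h.left.a_mem)
    · rintro rfl
      exact h.right.v_ne_w (hΓ.disjoint _ h.left.w_mem _ h.right.w_mem _ h.left.b_mem hz)
  have h2 : ∀ z ∈ v, z ≠ c ∧ z ≠ d := by
    intro z hz
    constructor
    · rintro rfl
      exact h.left.v_ne_w (hΓ.disjoint _ h.left.v_mem _ h.right.v_mem _ hz h.right.a_mem)
    · rintro rfl
      exact h.xv (hΓ.disjoint _ h.right.w_mem _ h.left.v_mem _ h.right.b_mem hz)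
  have h1 := h1 z
  have h2 := h2 z
  tauto

theorem contract_contract (hΓ : Γ.Admissible) {e f : Sym2 ℕ} (he : e ∈ Γ.T) (hf : f ∈ Γ.T)
    (hne : e ≠ f) : (Γ.contract e).contract f = (Γ.contract f).contract e := by
  ext1
  · rcases hΓ.far_or_near he hf hne with
      ⟨a, b, c, d, v, w, x, y, rfl, rfl, h⟩ | ⟨a, b, c, d, v, w, x, rfl, rfl, h⟩
    · ext u
      rw [(h.contract_right hΓ).mem_V (h.left.admissible_contract hΓ),
        (h.symm.contract_right hΓ).mem_V (h.right.admissible_contract hΓ),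
        h.left.mem_V hΓ, h.right.mem_V hΓ, h.merged_eq hΓ, h.symm.merged_eq hΓ]
      have hm := h.left.merged_not_mem hΓ
      have hm' := h.right.merged_not_mem hΓ
      have h1 : ∀ z ∈ Γ.V, Γ.mergedVertex s(a, b) ≠ z := fun z hz hz' => hm (hz' ▸ hz)
      have h2 : ∀ z ∈ Γ.V, Γ.mergedVertex s(c, d) ≠ z := fun z hz hz' => hm' (hz' ▸ hz)
      have h3 := h1 x h.right.v_mem
      have h4 := h1 y h.right.w_mem
      have h5 := h2 v h.left.v_mem
      have h6 := h2 w h.left.w_mem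
      constructor
      · rintro (rfl | ⟨rfl | h7, h8⟩) <;> tauto
      · rintro (rfl | ⟨rfl | h7, h8⟩) <;> tauto
    · ext u
      rw [(h.contract_right hΓ).mem_V (h.left.admissible_contract hΓ),
        (h.contract_left hΓ).mem_V (h.right.admissible_contract hΓ),
        h.left.mem_V hΓ, h.right.mem_V hΓ, h.merged_eq hΓ]
      have hm : u ∈ Γ.V → u ≠ Γ.mergedVertex s(a, b) :=
        fun hz hz' => h.left.merged_not_mem hΓ (hz' ▸ hz)
      have hm' : u ∈ Γ.V → u ≠ Γ.mergedVertex s(c, d) :=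
        fun hz hz' => h.right.merged_not_mem hΓ (hz' ▸ hz)
      tauto
  · exact Finset.erase_right_comm
  · rfl
  · exact Finset.erase_right_comm

/-- The set of symbols of an orientation after contraction. -/
theorem contractOrientation_mem (hΓ : Γ.Admissible) {e : Sym2 ℕ} (he : e ∈ Γ.T) {ω : Wedge R}
    (hω : ω ∈ orderings R (Γ.orientationSet n)) : Γ.contractOrientation R n e ω ∈
      orderings R ((Γ.contract e).orientationSet n) := by
  unfold contractOrientation
  unfold orientationSet at *
  split_ifs at * with hn
  · refine der_mem_orderings (X := {x | ∃ e ∈ Γ.T, x = .edge e}) ⟨e, he, rfl⟩ ?_ hω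
    rintro y
    simp only [contract, Finset.mem_erase, Set.mem_ofPred_eq]
    constructor
    · rintro ⟨f, hf, rfl⟩
      exact ⟨⟨f, hf.2, rfl⟩, fun h => hf.1 (Label.edge.inj h)⟩
    · rintro ⟨⟨f, hf, rfl⟩, h⟩
      exact ⟨f, ⟨fun h' => h (h' ▸ rfl), hf⟩, rfl⟩
  · induction e using Sym2.ind with | _ a b => ?_
    obtain ⟨v, w, h⟩ := hΓ.edgeAt he
    simp only [Sym2.lift_mk, LinearMap.comp_apply]
    rw [hΓ.vertexOf_eq h.v_mem h.a_mem, hΓ.vertexOf_eq h.w_mem h.b_mem]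
    set X : Set Label := {x | (∃ v ∈ Γ.V, (∀ i, v ≠ {Γ.hair i}) ∧ x = .vert v) ∨
      (∃ h ∈ Γ.H, x = .half h) ∨ ∃ e ∈ Γ.E, e ∉ Γ.T ∧ x = .edge e} with hX
    have xb : Label.half b ∈ X := Or.inr (Or.inl ⟨b, mem_H.2 ⟨w, h.w_mem, h.b_mem⟩, rfl⟩)
    have xa : Label.half a ∈ X := Or.inr (Or.inl ⟨a, mem_H.2 ⟨v, h.v_mem, h.a_mem⟩, rfl⟩)
    have xw : Label.vert w ∈ X := Or.inl ⟨w, h.w_mem, h.w_int, rfl⟩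
    have xv : Label.vert v ∈ X := Or.inl ⟨v, h.v_mem, h.v_int, rfl⟩
    have hb := der_mem_orderings (Y := {y | y ∈ X ∧ y ≠ .half b}) xb (fun y => Iff.rfl) hω
    have ha := der_mem_orderings (x := .half a) (X := {y | y ∈ X ∧ y ≠ .half b})
      (Y := {y | (y ∈ X ∧ y ≠ .half b) ∧ y ≠ .half a})
      ⟨xa, fun h' => h.a_ne_b (Label.half.inj h')⟩ (fun y => Iff.rfl) hb
    have hw := der_mem_orderings (x := .vert w)
      (X := {y | (y ∈ X ∧ y ≠ .half b) ∧ y ≠ .half a})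
      (Y := {y | ((y ∈ X ∧ y ≠ .half b) ∧ y ≠ .half a) ∧ y ≠ .vert w})
      ⟨⟨xw, by simp⟩, by simp⟩ (fun y => Iff.rfl) ha
    have hv := der_mem_orderings (x := .vert v)
      (X := {y | ((y ∈ X ∧ y ≠ .half b) ∧ y ≠ .half a) ∧ y ≠ .vert w})
      (Y := {y | (((y ∈ X ∧ y ≠ .half b) ∧ y ≠ .half a) ∧ y ≠ .vert w) ∧ y ≠ .vert v})
      ⟨⟨⟨xv, by simp⟩, by simp⟩, fun h' => h.v_ne_w (Label.vert.inj h')⟩ (fun y => Iff.rfl) hw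
    refine wedge_mem_orderings ?_ ?_ hv
    · rintro ⟨⟨⟨⟨h1, -⟩, -⟩, -⟩, -⟩
      rcases h1 with ⟨u, hu, -, h1⟩ | ⟨u, -, h1⟩ | ⟨u, -, -, h1⟩
      · exact h.merged_not_mem hΓ ((Label.vert.inj h1) ▸ hu)
      · simp at h1
      · simp at h1
    · have hmi : ∀ i, Γ.mergedVertex s(a, b) ≠ {Γ.hair i} := by
        intro i hi
        have := h.merged_card_ge hΓ
        rw [hi, Finset.card_singleton] at this
        omega
      intro y
      simp only [hX, Set.mem_ofPred_eq, h.mem_V hΓ, h.mem_H hΓ]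
      cases y with
      | half z => simp [and_assoc, and_comm]
      | vert u =>
        simp only [contract, Label.vert.injEq, reduceCtorEq, and_false, exists_false, or_false,
          ne_eq, not_false_eq_true, and_true]
        have : u = Γ.mergedVertex s(a, b) → ∀ i, u ≠ {Γ.hair i} := fun h => h ▸ hmi
        constructor
        · rintro ⟨z, hz, hz', rfl⟩
          rcases hz with hz | ⟨h1, h2, h3⟩
          · exact Or.inr hz
          · exact Or.inl ⟨⟨⟨u, h1, hz', rfl⟩, h3⟩, h2⟩
        · rintro (⟨⟨⟨z, hz, hz', rfl⟩, h1⟩, h2⟩ | h1)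
          · exact ⟨u, by tauto, hz', rfl⟩
          · exact ⟨u, Or.inl h1, this h1, rfl⟩
      | edge f =>
        have := h.mem_T
        simp only [contract, Finset.mem_erase, reduceCtorEq, and_false, exists_false,
          Label.edge.injEq, false_or, ne_eq, not_false_eq_true, and_true, or_false]
        constructor
        · rintro ⟨z, hz, hz', rfl⟩
          exact ⟨f, hz.2, fun h => hz' ⟨hz.1, h⟩, rfl⟩
        · rintro ⟨z, hz, hz', rfl⟩
          exact ⟨f, ⟨fun h => hz' (h ▸ this), hz⟩, fun h => hz' h.2, rfl⟩

theorem unmarkOrientation_mem (hΓ : Γ.Admissible) {e : Sym2 ℕ} (he : e ∈ Γ.T) {ω : Wedge R}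
    (hω : ω ∈ orderings R (Γ.orientationSet n)) : unmarkOrientation R n e ω ∈
      orderings R ((Γ.unmark e).orientationSet n) := by
  unfold unmarkOrientation
  unfold orientationSet at *
  split_ifs at * with hn
  · refine der_mem_orderings (X := {x | ∃ e ∈ Γ.T, x = .edge e}) ⟨e, he, rfl⟩ ?_ hω
    rintro y
    simp only [unmark, Finset.mem_erase, Set.mem_ofPred_eq]
    constructor
    · rintro ⟨f, hf, rfl⟩
      exact ⟨⟨f, hf.2, rfl⟩, fun h => hf.1 (Label.edge.inj h)⟩
    · rintro ⟨⟨f, hf, rfl⟩, h⟩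
      exact ⟨f, ⟨fun h' => h (h' ▸ rfl), hf⟩, rfl⟩
  · refine wedge_mem_orderings ?_ ?_ hω
    · rintro (⟨u, -, -, h1⟩ | ⟨u, -, h1⟩ | ⟨u, -, h1, h2⟩)
      · simp at h1
      · simp at h1
      · exact h1 (Label.edge.inj h2 ▸ he)
    · intro y
      have hE := hΓ.marked_subset he
      cases y with
      | half z => simp [unmark, H]
      | vert u => simp [unmark]
      | edge f =>
        simp only [unmark, Finset.mem_erase, reduceCtorEq, and_false, exists_false,
          Label.edge.injEq, false_or, Set.mem_ofPred_eq]
        constructor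
        · rintro ⟨z, hz, hz', rfl⟩
          by_cases h : f = e
          · exact Or.inr h
          · exact Or.inl ⟨f, hz, fun h' => hz' ⟨h, h'⟩, rfl⟩
        · rintro (⟨z, hz, hz', rfl⟩ | rfl)
          · exact ⟨f, hz, fun h => hz' h.2, rfl⟩
          · exact ⟨f, hE, fun h => h.1 rfl, rfl⟩

theorem der_vert_merged (h : Γ.EdgeAt a b v w) (hΓ : Γ.Admissible) (hn : ¬ Even n) {ω : Wedge R}
    (hω : ω ∈ orderings R (Γ.orientationSet n)) :
    der (.vert (Γ.mergedVertex s(a, b))) ω = 0 := by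
  refine der_eq_zero ?_ hω
  rw [orientationSet, if_neg hn]
  rintro (⟨u, hu, -, h1⟩ | ⟨u, -, h1⟩ | ⟨u, -, -, h1⟩)
  · exact h.merged_not_mem hΓ ((Label.vert.inj h1) ▸ hu)
  · simp at h1
  · simp at h1

theorem contractOrientation_odd (hn : ¬ Even n) (h : Γ.EdgeAt a b v w) (hΓ : Γ.Admissible)
    (ω : Wedge R) : Γ.contractOrientation R n s(a, b) ω =
      wedge (.vert (Γ.mergedVertex s(a, b)))
        (der (.vert v) (der (.vert w) (der (.half a) (der (.half b) ω)))) := by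
  simp only [contractOrientation, if_neg hn, Sym2.lift_mk, LinearMap.comp_apply,
    hΓ.vertexOf_eq h.v_mem h.a_mem, hΓ.vertexOf_eq h.w_mem h.b_mem]

theorem contractOrientation_anticomm (hΓ : Γ.Admissible) {e f : Sym2 ℕ} (he : e ∈ Γ.T)
    (hf : f ∈ Γ.T) (hne : e ≠ f) {ω : Wedge R} (hω : ω ∈ orderings R (Γ.orientationSet n)) :
    (Γ.contract e).contractOrientation R n f (Γ.contractOrientation R n e ω) =
      - (Γ.contract f).contractOrientation R n e (Γ.contractOrientation R n f ω) := by
  by_cases hn : Even n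
  · simp only [contractOrientation, if_pos hn]
    exact der_der _ _ _
  rcases hΓ.far_or_near he hf hne with
    ⟨a, b, c, d, v, w, x, y, rfl, rfl, h⟩ | ⟨a, b, c, d, v, w, x, rfl, rfl, h⟩
  · rw [contractOrientation_odd hn h.left hΓ, contractOrientation_odd hn h.right hΓ,
      contractOrientation_odd hn (h.contract_right hΓ) (h.left.admissible_contract hΓ),
      contractOrientation_odd hn (h.symm.contract_right hΓ) (h.right.admissible_contract hΓ),
      h.merged_eq hΓ, h.symm.merged_eq hΓ]
    have h1 : ∀ z ∈ Γ.V, Label.vert z ≠ .vert (Γ.mergedVertex s(a, b)) :=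
      fun z hz hz' => h.left.merged_not_mem hΓ (Label.vert.inj hz' ▸ hz)
    have h2 : ∀ z ∈ Γ.V, Label.vert z ≠ .vert (Γ.mergedVertex s(c, d)) :=
      fun z hz hz' => h.right.merged_not_mem hΓ (Label.vert.inj hz' ▸ hz)
    have key : ∀ P : Wedge R →ₗ[R] Wedge R,
        (∀ ω, P (wedge (.vert (Γ.mergedVertex s(a, b))) ω) =
          - wedge (.vert (Γ.mergedVertex s(a, b))) (P ω)) →
        (∀ l ω, l ∈ [Label.vert v, .vert w, .half a, .half b] → P (der l ω) = - der l (P ω)) →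
        ∀ ω, P (wedge (.vert (Γ.mergedVertex s(a, b)))
          (der (.vert v) (der (.vert w) (der (.half a) (der (.half b) ω))))) =
          - wedge (.vert (Γ.mergedVertex s(a, b)))
          (der (.vert v) (der (.vert w) (der (.half a) (der (.half b) (P ω))))) := by
      intro P hP hP' ω
      rw [hP, hP' _ _ (by simp), hP' _ _ (by simp), hP' _ _ (by simp), hP' _ _ (by simp)]
      simp only [map_neg, neg_neg]
    have kd : ∀ z : Label, z ≠ .vert (Γ.mergedVertex s(a, b)) → ∀ ω : Wedge R, _ := fun z hz =>
      key (der z) (fun ω => der_wedge_ne hz ω) (fun l ω _ => der_der _ _ _)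
    have kw := key (wedge (.vert (Γ.mergedVertex s(c, d)))) (fun ω => wedge_wedge _ _ _) (by
      intro l ω hl
      rw [der_wedge_ne, neg_neg]
      simp only [List.mem_cons, List.not_mem_nil, or_false] at hl
      rcases hl with rfl | rfl | rfl | rfl
      · exact h2 _ h.left.v_mem
      · exact h2 _ h.left.w_mem
      · simp
      · simp)
    simp only [kd (.half d) (by simp), kd (.half c) (by simp), kd (.vert y) (h1 _ h.right.w_mem),
      kd (.vert x) (h1 _ h.right.v_mem), kw, map_neg, neg_neg]
  · rw [contractOrientation_odd hn h.left hΓ, contractOrientation_odd hn h.right hΓ,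
      contractOrientation_odd hn (h.contract_right hΓ) (h.left.admissible_contract hΓ),
      contractOrientation_odd hn (h.contract_left hΓ) (h.right.admissible_contract hΓ),
      h.merged_eq hΓ]
    have h0 := der_vert_merged h.left hΓ hn hω
    have h0' := der_vert_merged h.right hΓ hn hω
    set p := Label.vert (Γ.mergedVertex s(a, b))
    set q := Label.vert (Γ.mergedVertex s(c, d))
    have h1 : ∀ z ∈ Γ.V, Label.vert z ≠ p :=
      fun z hz hz' => h.left.merged_not_mem hΓ (Label.vert.inj hz' ▸ hz)
    have h2 : ∀ z ∈ Γ.V, Label.vert z ≠ q :=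
      fun z hz hz' => h.right.merged_not_mem hΓ (Label.vert.inj hz' ▸ hz)
    rw [← map_neg]
    congr 1
    rw [der_wedge_ne (x := .half d) (y := p) (by simp [p]), map_neg,
      der_wedge_ne (x := .half c) (y := p) (by simp [p]), neg_neg,
      der_wedge_ne (h1 _ h.right.w_mem), map_neg, der_wedge_self,
      der_wedge_ne (x := .half b) (y := q) (by simp [q]), map_neg,
      der_wedge_ne (x := .half a) (y := q) (by simp [q]), neg_neg,
      der_wedge_self]
    simp only [der_der p, h0, der_der q, h0', map_zero, neg_zero, sub_zero, neg_inj]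
    simp only [der_der (.half d) (.vert v), der_der (.half d) (.vert w),
      der_der (.half d) (.half a), der_der (.half d) (.half b), der_der (.half c) (.vert v),
      der_der (.half c) (.vert w), der_der (.half c) (.half a), der_der (.half c) (.half b),
      der_der (.vert x) (.vert v), der_der (.vert x) (.vert w), der_der (.half b) (.vert w),
      der_der (.half b) (.vert x), der_der (.half a) (.vert w), der_der (.half a) (.vert x),
      map_neg, neg_neg]

end MarkedGraph

namespace MarkedGraph

variable {Γ : MarkedGraph r}

theorem unmark_contractOrientation (Γ : MarkedGraph r) (e f : Sym2 ℕ) (ω : Wedge R) :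
    unmarkOrientation R n f (Γ.contractOrientation R n e ω) =
      - Γ.contractOrientation R n e (unmarkOrientation R n f ω) := by
  unfold unmarkOrientation contractOrientation
  split_ifs
  · exact der_der _ _ _
  · induction e using Sym2.ind with | _ a b => ?_
    simp only [Sym2.lift_mk, LinearMap.comp_apply]
    have h1 : ∀ (v : Finset ℕ) (ω : Wedge R), der (.vert v) (wedge (.edge f) ω) =
        - wedge (.edge f) (der (.vert v) ω) := fun v ω => der_wedge_ne (by simp) ω
    have h2 : ∀ (h : ℕ) (ω : Wedge R), der (.half h) (wedge (.edge f) ω) =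
        - wedge (.edge f) (der (.half h) ω) := fun v ω => der_wedge_ne (by simp) ω
    simp only [h1, h2, map_neg, neg_neg]
    exact wedge_wedge _ _ _

theorem unmark_unmarkOrientation (e f : Sym2 ℕ) (ω : Wedge R) :
    unmarkOrientation R n f (unmarkOrientation R n e ω) =
      - unmarkOrientation R n e (unmarkOrientation R n f ω) := by
  unfold unmarkOrientation
  split_ifs
  · exact der_der _ _ _
  · exact wedge_wedge _ _ _

theorem contract_unmark (Γ : MarkedGraph r) (e f : Sym2 ℕ) :
    (Γ.contract e).unmark f = (Γ.unmark f).contract e := by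
  ext1
  · rfl
  · rfl
  · rfl
  · exact Finset.erase_right_comm

theorem unmark_unmark (Γ : MarkedGraph r) (e f : Sym2 ℕ) :
    (Γ.unmark e).unmark f = (Γ.unmark f).unmark e := by
  ext1
  · rfl
  · rfl
  · rfl
  · exact Finset.erase_right_comm

end MarkedGraph

variable (R n r) in
/-- The total differential `d = d_c + d_u`. -/
def differential : Ambient R r →ₗ[R] Ambient R r := dc R n r + du R n r

theorem differential_cls (Γ : MarkedGraph r) (ω : Wedge R) : differential R n r (cls Γ ω) =
    ∑ e ∈ Γ.T, (cls (Γ.contract e) (Γ.contractOrientation R n e ω) +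
      cls (Γ.unmark e) (MarkedGraph.unmarkOrientation R n e ω)) := by
  rw [differential, LinearMap.add_apply, dc_cls, du_cls, Finset.sum_add_distrib]

theorem sum_sum_erase_eq_zero {ι M : Type*} [DecidableEq ι] [AddCommGroup M] (T : Finset ι)
    (F : ι → ι → M) (hF : ∀ e ∈ T, ∀ f ∈ T, e ≠ f → F e f + F f e = 0) :
    ∑ e ∈ T, ∑ f ∈ T.erase e, F e f = 0 := by
  rw [Finset.sum_sigma']
  refine Finset.sum_involution (fun p _ => ⟨p.2, p.1⟩) ?_ ?_ ?_ ?_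
  · rintro ⟨e, f⟩ h
    simp only [Finset.mem_sigma, Finset.mem_erase] at h
    exact hF e h.1 f h.2.2 h.2.1.symm
  · rintro ⟨e, f⟩ h _ h'
    simp only [Finset.mem_sigma, Finset.mem_erase] at h
    exact h.2.1 (congrArg Sigma.fst h')
  · rintro ⟨e, f⟩ h
    simp only [Finset.mem_sigma, Finset.mem_erase] at h ⊢
    exact ⟨h.2.2, h.2.1.symm, h.1⟩
  · rintro ⟨e, f⟩ _
    rfl

theorem differential_differential_cls {Γ : MarkedGraph r} (hΓ : Γ.Admissible) {ω : Wedge R}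
    (hω : ω ∈ orderings R (Γ.orientationSet n)) :
    differential R n r (differential R n r (cls Γ ω)) = 0 := by
  rw [differential_cls, map_sum]
  let F : Sym2 ℕ → Sym2 ℕ → Ambient R r := fun e f =>
    (cls ((Γ.contract e).contract f)
        ((Γ.contract e).contractOrientation R n f (Γ.contractOrientation R n e ω)) +
      cls ((Γ.contract e).unmark f)
        (MarkedGraph.unmarkOrientation R n f (Γ.contractOrientation R n e ω))) +
    (cls ((Γ.unmark e).contract f)
        (Γ.contractOrientation R n f (MarkedGraph.unmarkOrientation R n e ω)) +
      cls ((Γ.unmark e).unmark f)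
        (MarkedGraph.unmarkOrientation R n f (MarkedGraph.unmarkOrientation R n e ω)))
  have h : ∀ e ∈ Γ.T, differential R n r (cls (Γ.contract e) (Γ.contractOrientation R n e ω) +
      cls (Γ.unmark e) (MarkedGraph.unmarkOrientation R n e ω)) =
      ∑ f ∈ Γ.T.erase e, F e f := by
    intro e _
    rw [map_add, differential_cls, differential_cls]
    exact Finset.sum_add_distrib.symm
  rw [Finset.sum_congr rfl h]
  refine sum_sum_erase_eq_zero _ _ fun e he f hf hne => ?_
  simp only [F]
  rw [Γ.contract_contract hΓ he hf hne, Γ.contractOrientation_anticomm hΓ he hf hne hω,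
    Γ.contract_unmark e f, Γ.unmark_contractOrientation e f, Γ.contract_unmark f e,
    Γ.unmark_contractOrientation f e, Γ.unmark_unmark e f,
    MarkedGraph.unmark_unmarkOrientation e f]
  simp only [map_neg]
  abel

variable (R n) in
/-- The span of the (isomorphism classes of) oriented admissible forested graphs with `r` hairs, loop
order `g`, `m` marked edges, and with the property `P`.  Here `m` is the homological degree. -/
def graphSpan (P : MarkedGraph r → Prop) (g m : ℕ) : Submodule R (Ambient R r) :=
  Submodule.span R {x | ∃ (Γ : MarkedGraph r) (ω : Wedge R), Γ.Admissible ∧ Γ.HasLoopOrder g ∧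
    Γ.T.card = m ∧ P Γ ∧ Γ.IsOrientation n ω ∧ x = cls Γ ω}

/-- The property `P` is preserved under contraction and unmarking of marked edges. -/
def IsStable (P : MarkedGraph r → Prop) : Prop :=
  ∀ Γ : MarkedGraph r, Γ.Admissible → P Γ → ∀ e ∈ Γ.T, P (Γ.contract e) ∧ P (Γ.unmark e)

theorem cls_mem_graphSpan {P : MarkedGraph r → Prop} {g m : ℕ} {Γ : MarkedGraph r}
    (hΓ : Γ.Admissible) (hg : Γ.HasLoopOrder g) (hm : Γ.T.card = m) (hP : P Γ) {ω : Wedge R}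
    (hω : ω ∈ orderings R (Γ.orientationSet n)) : cls Γ ω ∈ graphSpan R n P g m := by
  induction hω using Submodule.span_induction with
  | mem ω h => exact Submodule.subset_span ⟨Γ, ω, hΓ, hg, hm, hP, h, rfl⟩
  | zero => simp
  | add a b _ _ ha hb => rw [map_add]; exact add_mem ha hb
  | smul c a _ ha => rw [map_smul]; exact Submodule.smul_mem _ _ ha

theorem differential_mem {P : MarkedGraph r → Prop} (hP : IsStable P) {g m : ℕ} :
    ∀ x ∈ graphSpan R n P g (m + 1), differential R n r x ∈ graphSpan R n P g m := by
  intro x hx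
  induction hx using Submodule.span_induction with
  | mem x h =>
    obtain ⟨Γ, ω, hΓ, hg, hm, hPΓ, hω, rfl⟩ := h
    have hω : ω ∈ orderings R (Γ.orientationSet n) := Submodule.subset_span hω
    rw [differential_cls]
    refine sum_mem fun e he => add_mem ?_ ?_
    · have hc := Γ.contractOrientation_mem hΓ he hω
      have hPc := (hP Γ hΓ hPΓ e he).1
      induction e using Sym2.ind with | _ a b => ?_
      obtain ⟨v, w, h⟩ := hΓ.edgeAt he
      refine cls_mem_graphSpan (h.admissible_contract hΓ) (h.loopOrder_contract hΓ hg) ?_ hPc hc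
      exact Nat.add_right_cancel ((Finset.card_erase_add_one he).trans hm)
    · refine cls_mem_graphSpan (hΓ.unmark e) hg ?_ (hP Γ hΓ hPΓ e he).2
        (Γ.unmarkOrientation_mem hΓ he hω)
      exact Nat.add_right_cancel ((Finset.card_erase_add_one he).trans hm)
  | zero => simp
  | add a b _ _ ha hb => rw [map_add]; exact add_mem ha hb
  | smul c a _ ha => rw [map_smul]; exact Submodule.smul_mem _ _ ha

theorem differential_differential {P : MarkedGraph r → Prop} {g m : ℕ} :
    ∀ x ∈ graphSpan R n P g m, differential R n r (differential R n r x) = 0 := by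
  intro x hx
  induction hx using Submodule.span_induction with
  | mem x h =>
    obtain ⟨Γ, ω, hΓ, -, -, -, hω, rfl⟩ := h
    exact differential_differential_cls hΓ (Submodule.subset_span hω)
  | zero => simp
  | add a b _ _ ha hb => rw [map_add, map_add, ha, hb, add_zero]
  | smul c a _ ha => rw [map_smul, map_smul, ha, smul_zero]

variable (R n) in
/-- The complex of oriented admissible forested graphs of loop order `g` with the property `P`, with
the differential `d_c + d_u`. -/
def graphComplex (P : MarkedGraph r → Prop) (hP : IsStable P) (g : ℕ) :
    ChainComplex (ModuleCat.{u} R) ℕ :=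
  ChainComplex.of (fun m => ModuleCat.of R (graphSpan R n P g m))
    (fun m => ModuleCat.ofHom ((differential R n r).restrict (differential_mem (m := m) hP)))
    (fun m => by
      refine ModuleCat.hom_ext (LinearMap.ext fun x => Subtype.ext ?_)
      exact differential_differential x.1 x.2)

theorem isStable_true : IsStable (fun _ : MarkedGraph r => True) :=
  fun _ _ _ _ _ => ⟨trivial, trivial⟩

theorem isStable_bridgeless : IsStable (MarkedGraph.Bridgeless (r := r)) := by
  intro Γ hΓ hb e he
  refine ⟨?_, hb⟩
  induction e using Sym2.ind with | _ a b => ?_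
  obtain ⟨v, w, h⟩ := hΓ.edgeAt he
  exact h.bridgeless_contract hΓ hb

variable (R n r)

/-- The `g`-loop part of the forested graph complex with `r` hairs, with differential
`d_c + d_u`. -/
def FG (g : ℕ) : ChainComplex (ModuleCat.{u} R) ℕ :=
  graphComplex R n (fun _ : MarkedGraph r => True) isStable_true g

/-- The subcomplex spanned by the bridgeless forested graphs. -/
def FGbl (g : ℕ) : ChainComplex (ModuleCat.{u} R) ℕ :=
  graphComplex R n (MarkedGraph.Bridgeless (r := r)) isStable_bridgeless g

theorem graphSpan_bridgeless_le (g m : ℕ) :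
    graphSpan R n (MarkedGraph.Bridgeless (r := r)) g m ≤ graphSpan R n (fun _ => True) g m :=
  Submodule.span_mono fun _ ⟨Γ, ω, h1, h2, h3, _, h5⟩ => ⟨Γ, ω, h1, h2, h3, trivial, h5⟩

/-- The inclusion of the bridgeless forested graph complex into the forested graph complex. -/
def blInclusion (g : ℕ) : FGbl R n r g ⟶ FG R n r g :=
  ChainComplex.ofHom
    (fun m => ModuleCat.ofHom (Submodule.inclusion (graphSpan_bridgeless_le R n r g m)))
    (fun m => by
      simp only [FG, FGbl, graphComplex, ChainComplex.of_d]
      ext x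
      rfl)

end Spaces

end ForestedGraphs

end

/-! Whether an edge is a bridge does not depend on the marking, and a bridge lies on no cycle.
Hence, for a fixed graph, each bridge may be marked or left unmarked independently of the rest of
the forest, and toggling one bridge makes the unmarking differential $d_u$ acyclic as soon as there
is a bridge. Isomorphisms permute the bridges, so no bridge can be singled out. Instead one averages
over all of them: let $h$ (`markBridges`) be the sum over the unmarked bridges of the graph with
that bridge marked, divided by the number of all bridges. This division is where $\mathbb{Q} \subset
R$ enters.

On a graph with at least one bridge, $d_u h + h d_u = 1$ (`du_markBridges_add`): the diagonal terms
return the graph once for each bridge, marked or not, and the other terms cancel by sign. The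
contraction part $d_c$ removes an edge, so $1 - dh - hd$ sends such a graph to graphs with fewer
edges (`sub_differential_markBridges_mem`). On bridgeless graphs both $h$ and $hd$ vanish.

Induction on the number of edges then gives the central statement `exists_eq_add_differential`: if
$h(dz) = 0$, then $z = a + dy$ with $a$ bridgeless. The hypothesis holds if $z$ is a cycle, which
gives surjectivity on homology. It also holds if $dz$ is bridgeless, which gives injectivity. This
replaces the spectral sequence of the filtration by the number of edges. -/

/-! ### Quasi-isomorphisms of complexes of modules, tested on elements -/

/-- A criterion for a morphism of chain complexes of modules to be a quasi-isomorphism, in terms of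
elements. -/
theorem ChainComplex.quasiIso_of_forall_exists.{u} {R : Type u} [Ring R]
    {K L : ChainComplex (ModuleCat.{u} R) ℕ} (φ : K ⟶ L)
    (hinj : ∀ (i j : ℕ), (ComplexShape.down ℕ).prev j = i → ∀ (x : K.X j) (y : L.X i),
      φ.f j x = L.d i j y → ∃ z : K.X i, x = K.d i j z)
    (hsurj : ∀ (i j k : ℕ), (ComplexShape.down ℕ).prev j = i → (ComplexShape.down ℕ).next j = k →
      ∀ y : L.X j, L.d j k y = 0 →
        ∃ (x : K.X j) (z : L.X i), K.d j k x = 0 ∧ y = φ.f j x + L.d i j z) :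
    QuasiIso φ := by
  -- Mono and epi on homology are tested up to refinement, that is, after an epimorphism onto the
  -- test object `A`. Elementwise choices of preimages need not be linear in `a : A`, but they
  -- extend linearly to the free module on the set `A`, which surjects onto `A`.
  have hcover : ∀ A : ModuleCat.{u} R,
      Epi (ModuleCat.ofHom (Finsupp.linearCombination R (id : A → A))) := fun A =>
    (ModuleCat.epi_iff_surjective _).2 (Finsupp.linearCombination_id_surjective R A)
  rw [quasiIso_iff]
  intro j
  rw [quasiIsoAt_iff_isIso_homologyMap]
  have : Mono (HomologicalComplex.homologyMap φ j) := by
    rw [HomologicalComplex.mono_homologyMap_iff_up_to_refinements φ _ j _ rfl rfl]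
    intro A x _ y hxy
    have h := fun a : A => hinj _ j rfl (x a) (y a) (ConcreteCategory.congr_hom hxy a)
    choose z hz using h
    refine ⟨_, _, hcover A, ModuleCat.ofHom (Finsupp.linearCombination R z), ?_⟩
    ext a
    simpa using hz a
  have : Epi (HomologicalComplex.homologyMap φ j) := by
    rw [HomologicalComplex.epi_homologyMap_iff_up_to_refinements φ _ j _ rfl rfl]
    intro A y hy
    have h := fun a : A => hsurj _ j _ rfl rfl (y a) (ConcreteCategory.congr_hom hy a)
    choose x z hx hz using h
    refine ⟨_, _, hcover A, ModuleCat.ofHom (Finsupp.linearCombination R x), ?_,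
      ModuleCat.ofHom (Finsupp.linearCombination R z), ?_⟩
    · ext a
      simpa using hx a
    · ext a
      simpa using hz a
  exact isIso_of_mono_of_epi _

noncomputable section

namespace ForestedGraphs

universe u

/-! ### Multiplication by a symbol against derivation by it -/

section Wedge

variable {R : Type u} [CommRing R]

theorem wedge_wedge_self (x : Label) (ω : Wedge R) : wedge x (wedge x ω) = 0 := by
  simp [wedge, ← mul_assoc]

theorem wedge_monomial_of_mem {x : Label} {l : List Label} (h : x ∈ l) :
    wedge x (monomial l : Wedge R) = 0 := by
  induction l with
  | nil => simp at h
  | cons y l ih =>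
    rw [monomial_cons]
    rcases List.mem_cons.1 h with rfl | h
    · exact wedge_wedge_self _ _
    · rw [wedge_wedge, ih h, map_zero, neg_zero]

theorem wedge_eq_zero {X : Set Label} {x : Label} (hx : x ∈ X) {ω : Wedge R}
    (h : ω ∈ orderings R X) : wedge x ω = 0 := by
  induction h using Submodule.span_induction with
  | mem ω h =>
    obtain ⟨l, -, h2, rfl⟩ := h
    exact wedge_monomial_of_mem ((h2 x).2 hx)
  | zero => simp
  | add a b _ _ ha hb => rw [map_add, ha, hb, add_zero]
  | smul c a _ ha => rw [map_smul, ha, smul_zero]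

/-- Apply the Leibniz rule $\partial_x(x \wedge \omega) = \omega - x \wedge \partial_x\omega$: the
left side vanishes because $x$ already occurs in $\omega$. Together with `der_wedge_of_notMem`,
where the last term vanishes instead, this makes marking and unmarking inverse to each other on
orientations, for both parities of $n$. -/
theorem wedge_der_of_mem {X : Set Label} {x : Label} (hx : x ∈ X) {ω : Wedge R}
    (h : ω ∈ orderings R X) : wedge x (der x ω) = ω := by
  have := der_wedge_self x ω
  rw [wedge_eq_zero hx h, map_zero] at this
  exact (sub_eq_zero.1 this.symm).symm

theorem der_wedge_of_notMem {X : Set Label} {x : Label} (hx : x ∉ X) {ω : Wedge R}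
    (h : ω ∈ orderings R X) : der x (wedge x ω) = ω := by
  rw [der_wedge_self, der_eq_zero hx h, map_zero, sub_zero]

end Wedge

variable {R : Type u} [CommRing R] {n : ℤ} {r : ℕ}

/-! ### Marking edges, bridges, and their invariance under isomorphism -/

namespace MarkedGraph

/-- The graph `(Γ, T ∪ {e})`, in which the edge `e` is marked. -/
def mark (Γ : MarkedGraph r) (e : Sym2 ℕ) : MarkedGraph r where
  V := Γ.V
  E := Γ.E
  hair := Γ.hair
  T := insert e Γ.T

open Classical in
/-- The set of bridges. -/
def bridges (Γ : MarkedGraph r) : Finset (Sym2 ℕ) := Γ.E.filter Γ.IsBridge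

variable (R) in
/-- The operation on orientations for the marking of an edge `e`, which is inverse to the one for
the unmarking: it is `e ∧ -` for `n` even and `∂ₑ` for `n` odd. -/
def markOrientation (n : ℤ) (e : Sym2 ℕ) : Wedge R →ₗ[R] Wedge R :=
  if Even n then wedge (.edge e) else der (.edge e)

variable {Γ : MarkedGraph r} {e f : Sym2 ℕ}

theorem mem_bridges : e ∈ Γ.bridges ↔ Γ.IsBridge e := by
  classical
  simp only [bridges, Finset.mem_filter, and_iff_right_iff_imp]
  exact fun h => h.1

theorem bridges_eq_empty_iff : Γ.bridges = ∅ ↔ Γ.Bridgeless := by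
  simp only [Finset.eq_empty_iff_forall_notMem, mem_bridges, Bridgeless]

theorem Linked.relabel (σ : Equiv.Perm ℕ) {S : Finset (Sym2 ℕ)} {a b : ℕ} (h : Γ.Linked S a b) :
    (Γ.relabel σ).Linked (S.image (Sym2.map σ)) (σ a) (σ b) := by
  refine Linked.lift σ ?_ ?_ h
  · intro v hv a ha b hb
    exact Linked.vertex (Finset.mem_image_of_mem _ hv) (Finset.mem_image_of_mem _ ha)
      (Finset.mem_image_of_mem _ hb)
  · intro a b hab
    exact Linked.edge (Finset.mem_image_of_mem (Sym2.map σ) hab)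

theorem H_relabel (σ : Equiv.Perm ℕ) (Γ : MarkedGraph r) : (Γ.relabel σ).H = Γ.H.image σ := by
  ext x
  simp only [mem_H, relabel, Finset.mem_image]
  constructor
  · rintro ⟨_, ⟨v, hv, rfl⟩, hx⟩
    obtain ⟨y, hy, rfl⟩ := Finset.mem_image.1 hx
    exact ⟨y, ⟨v, hv, hy⟩, rfl⟩
  · rintro ⟨y, ⟨v, hv, hy⟩, rfl⟩
    exact ⟨_, ⟨v, hv, rfl⟩, Finset.mem_image_of_mem _ hy⟩

/-- Turns one-sided transport statements into equivalences, by applying them to the inverse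
permutation. -/
theorem relabel_symm_relabel (σ : Equiv.Perm ℕ) (Γ : MarkedGraph r) :
    (Γ.relabel σ).relabel σ.symm = Γ := by
  have h : Sym2.map σ.symm ∘ Sym2.map σ = id := by
    rw [← Sym2.map_comp, Equiv.symm_comp_self, Sym2.map_id]
  ext1
  · simp [relabel, Finset.image_image, Function.comp_def]
  · simp only [relabel, Finset.image_image, h, Finset.image_id]
  · simp [relabel, Function.comp_def]
  · simp only [relabel, Finset.image_image, h, Finset.image_id]

theorem ConnectedBy.relabel (σ : Equiv.Perm ℕ) {S : Finset (Sym2 ℕ)} (h : Γ.ConnectedBy S) :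
    (Γ.relabel σ).ConnectedBy (S.image (Sym2.map σ)) := by
  rw [ConnectedBy, H_relabel]
  refine ⟨h.1.image _, ?_⟩
  simp only [Finset.forall_mem_image]
  exact fun a ha b hb => (h.2 a ha b hb).relabel σ

theorem connectedBy_relabel_iff (σ : Equiv.Perm ℕ) {S : Finset (Sym2 ℕ)} :
    (Γ.relabel σ).ConnectedBy (S.image (Sym2.map σ)) ↔ Γ.ConnectedBy S := by
  refine ⟨fun h => ?_, fun h => h.relabel σ⟩
  have := h.relabel σ.symm
  rwa [relabel_symm_relabel, Finset.image_image, ← Sym2.map_comp, Equiv.symm_comp_self, Sym2.map_id,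
    Finset.image_id] at this

theorem isBridge_relabel_iff (σ : Equiv.Perm ℕ) :
    (Γ.relabel σ).IsBridge (e.map σ) ↔ Γ.IsBridge e := by
  have h := Sym2.map.injective σ.injective
  have h1 : (Γ.relabel σ).E = Γ.E.image (Sym2.map σ) := rfl
  have h2 : ∀ i, (Γ.relabel σ).hair i = σ (Γ.hair i) := fun _ => rfl
  simp only [IsBridge, h1, h2, map_mem_map, h.mem_finset_image]
  rw [← Finset.image_erase h, connectedBy_relabel_iff]

/-- Needed for the homotopy to descend to isomorphism classes: both its index set and its
denominator are expressed through the bridges. -/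
theorem bridges_relabel (σ : Equiv.Perm ℕ) (Γ : MarkedGraph r) :
    (Γ.relabel σ).bridges = Γ.bridges.image (Sym2.map σ) := by
  have h := Sym2.map.injective σ.injective
  ext e
  rw [mem_bridges, Finset.mem_image]
  constructor
  · intro he
    obtain ⟨f, -, rfl⟩ := Finset.mem_image.1 he.1
    exact ⟨f, mem_bridges.2 ((isBridge_relabel_iff σ).1 he), rfl⟩
  · rintro ⟨f, hf, rfl⟩
    exact (isBridge_relabel_iff σ).2 (mem_bridges.1 hf)

theorem mark_relabel (σ : Equiv.Perm ℕ) (Γ : MarkedGraph r) (e : Sym2 ℕ) :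
    (Γ.relabel σ).mark (e.map σ) = (Γ.mark e).relabel σ := by
  ext1 <;> simp only [mark, relabel, Finset.image_insert]

theorem markOrientation_relabel (σ : Equiv.Perm ℕ) (e : Sym2 ℕ) (ω : Wedge R) :
    markOrientation R n (e.map σ) (Wedge.relabel σ ω) =
      Wedge.relabel σ (markOrientation R n e ω) := by
  unfold markOrientation
  split_ifs
  · rw [relabel_wedge]; rfl
  · rw [relabel_der]; rfl

/-! ### Paths through a bridge, and marking a bridge -/

/-- A path using the edges in `S` and the edge `s(c, d)` may be shortened so that it uses the latter
at most once. -/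
theorem Linked.of_insert {S : Finset (Sym2 ℕ)} {a b c d : ℕ} (h : Γ.Linked (insert s(c, d) S) a b) :
    Γ.Linked S a b ∨ (Γ.Linked S a c ∧ Γ.Linked S d b) ∨ (Γ.Linked S a d ∧ Γ.Linked S c b) := by
  have tr : ∀ {x y z : ℕ}, Γ.Linked S x y → Γ.Linked S y z → Γ.Linked S x z :=
    fun h k => Relation.EqvGen.trans _ _ _ h k
  have sy : ∀ {x y : ℕ}, Γ.Linked S x y → Γ.Linked S y x := fun h => Relation.EqvGen.symm _ _ h
  have re : ∀ x, Γ.Linked S x x := fun x => Relation.EqvGen.refl x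
  induction h with
  | rel a b hab =>
    rcases hab with ⟨v, hv, ha, hb⟩ | hab
    · exact Or.inl (Linked.vertex hv ha hb)
    · rcases Finset.mem_insert.1 hab with hab | hab
      · rcases Sym2.eq_iff.1 hab with ⟨rfl, rfl⟩ | ⟨rfl, rfl⟩
        · exact Or.inr (Or.inl ⟨re _, re _⟩)
        · exact Or.inr (Or.inr ⟨re _, re _⟩)
      · exact Or.inl (Linked.edge hab)
  | refl a => exact Or.inl (re a)
  | symm a b _ ih =>
    rcases ih with h | ⟨h, k⟩ | ⟨h, k⟩
    · exact Or.inl (sy h)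
    · exact Or.inr (Or.inr ⟨sy k, sy h⟩)
    · exact Or.inr (Or.inl ⟨sy k, sy h⟩)
  | trans a b c' _ _ ih1 ih2 =>
    rcases ih1 with h | ⟨h, k⟩ | ⟨h, k⟩ <;> rcases ih2 with h' | ⟨h', k'⟩ | ⟨h', k'⟩
    · exact Or.inl (tr h h')
    · exact Or.inr (Or.inl ⟨tr h h', k'⟩)
    · exact Or.inr (Or.inr ⟨tr h h', k'⟩)
    · exact Or.inr (Or.inl ⟨h, tr k h'⟩)
    · exact Or.inr (Or.inl ⟨h, k'⟩)
    -- The edge is crossed from `c` to `d` and later back from `d` to `c`, so the excursion between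
    -- the two visits to `c` can be cut out.
    · exact Or.inl (tr h k')
    · exact Or.inr (Or.inr ⟨h, tr k h'⟩)
    · exact Or.inl (tr h k')
    · exact Or.inr (Or.inr ⟨h, k'⟩)

/-- The endpoints of a bridge are not joined by a path avoiding the bridge. -/
theorem IsBridge.not_linked (hΓ : Γ.Admissible) {c d : ℕ} (h : Γ.IsBridge s(c, d))
    {S : Finset (Sym2 ℕ)} (hS : S ⊆ Γ.E.erase s(c, d)) : ¬ Γ.Linked S c d := by
  intro hl
  have hl := Linked.mono hS hl
  refine h.2.2 ⟨hΓ.connected.1, fun a ha b hb => ?_⟩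
  have hab := hΓ.connected.2 a ha b hb
  -- If `c` and `d` were joined without the bridge, each crossing of the bridge could be replaced by
  -- that detour, and the graph would stay connected after removing it.
  rw [← Finset.insert_erase h.1] at hab
  rcases hab.of_insert with h | ⟨h, k⟩ | ⟨h, k⟩
  · exact h
  · exact Relation.EqvGen.trans _ _ _ (Relation.EqvGen.trans _ _ _ h hl) k
  · exact Relation.EqvGen.trans _ _ _
      (Relation.EqvGen.trans _ _ _ h (Relation.EqvGen.symm _ _ hl)) k

/-- Only the forest condition is at stake. A cycle created by marking `e` would pass through `e` and
join its endpoints by other edges, which is impossible for a bridge. -/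
theorem IsBridge.admissible_mark (hΓ : Γ.Admissible) (h : Γ.IsBridge e) (he : e ∉ Γ.T) :
    (Γ.mark e).Admissible where
  disjoint := hΓ.disjoint
  edge_ne := hΓ.edge_ne
  edge_mem := hΓ.edge_mem
  edge_unique := hΓ.edge_unique
  hair_injective := hΓ.hair_injective
  hair_mem := hΓ.hair_mem
  valence := hΓ.valence
  connected := hΓ.connected
  marked_subset := Finset.insert_subset h.1 hΓ.marked_subset
  marked_hair := by
    intro f hf i
    rcases Finset.mem_insert.1 hf with rfl | hf
    · exact h.2.1 i
    · exact hΓ.marked_hair f hf i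
  forest := by
    have hT : Γ.T ⊆ Γ.E.erase e := fun f hf =>
      Finset.mem_erase.2 ⟨fun h' => he (h' ▸ hf), hΓ.marked_subset hf⟩
    induction e using Sym2.ind with | _ c d => ?_
    intro a b hab hl
    -- `Linked` depends on the graph only through its vertices, which marking does not change.
    replace hl : Γ.Linked ((insert s(c, d) Γ.T).erase s(a, b)) a b := hl
    rcases Finset.mem_insert.1 hab with hab | hab
    · rw [hab, Finset.erase_insert he] at hl
      rcases Sym2.eq_iff.1 hab with ⟨rfl, rfl⟩ | ⟨rfl, rfl⟩
      · exact h.not_linked hΓ hT hl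
      · exact h.not_linked hΓ hT (Relation.EqvGen.symm _ _ hl)
    · have hne : s(c, d) ≠ s(a, b) := fun h' => he (h' ▸ hab)
      rw [Finset.erase_insert_of_ne hne] at hl
      have hm : ∀ {x y : ℕ}, Γ.Linked (Γ.T.erase s(a, b)) x y → Γ.Linked Γ.T x y :=
        fun hxy => Linked.mono (Finset.erase_subset _ _) hxy
      have hab' : Γ.Linked Γ.T a b := Linked.edge hab
      rcases hl.of_insert with h1 | ⟨h1, h2⟩ | ⟨h1, h2⟩
      · exact hΓ.forest a b hab h1
      -- The path from `a` to `b` uses the new edge. Its two remaining pieces, closed up by the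
      -- marked edge `s(a, b)`, join `c` to `d` inside `Γ.T`.
      · refine h.not_linked hΓ hT (Relation.EqvGen.trans _ a _ (Relation.EqvGen.symm _ _ (hm h1)) ?_)
        exact Relation.EqvGen.trans _ b _ hab' (Relation.EqvGen.symm _ _ (hm h2))
      · exact h.not_linked hΓ hT (Relation.EqvGen.trans _ b _ (hm h2)
          (Relation.EqvGen.trans _ a _ (Relation.EqvGen.symm _ _ hab') (hm h1)))

/-! ### Orientations under marking -/

theorem mem_orientationSet_mark {x : Label} (hx : x ≠ .edge e) :
    x ∈ (Γ.mark e).orientationSet n ↔ x ∈ Γ.orientationSet n := by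
  unfold orientationSet
  cases x with
  | half z => split_ifs <;> simp [mark, H]
  | vert z => split_ifs <;> simp [mark, H]
  | edge f =>
    have : f ≠ e := fun h => hx (h ▸ rfl)
    split_ifs <;> simp [mark, H, this]

/-- For $n$ even marking adds the symbol of `e`. For $n$ odd it removes this symbol, since there the
unmarked edges are the ones that are ordered. -/
theorem markOrientation_mem (he : e ∈ Γ.E) (heT : e ∉ Γ.T) {ω : Wedge R}
    (hω : ω ∈ orderings R (Γ.orientationSet n)) : markOrientation R n e ω ∈
      orderings R ((Γ.mark e).orientationSet n) := by
  have key := fun x => mem_orientationSet_mark (Γ := Γ) (e := e) (n := n) (x := x)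
  unfold markOrientation
  split_ifs with hn
  · refine wedge_mem_orderings ?_ ?_ hω
    · simp [orientationSet, hn, heT]
    · intro y
      by_cases hy : y = .edge e
      · subst hy
        simp [orientationSet, hn, mark]
      · simp [key y hy, hy]
  · refine der_mem_orderings ?_ ?_ hω
    · simp [orientationSet, hn, heT, he]
    · intro y
      by_cases hy : y = .edge e
      · subst hy
        simp [orientationSet, hn, mark]
      · simp [key y hy, hy]

/-- The restriction to orderings matters: on the whole exterior algebra neither composite of $x
\wedge -$ and $\partial_x$ is the identity. -/
theorem unmark_markOrientation_self (he : e ∈ Γ.E) (heT : e ∉ Γ.T) {ω : Wedge R}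
    (hω : ω ∈ orderings R (Γ.orientationSet n)) :
    unmarkOrientation R n e (markOrientation R n e ω) = ω := by
  unfold unmarkOrientation markOrientation
  split_ifs with hn
  · exact der_wedge_of_notMem (by simp [orientationSet, hn, heT]) hω
  · exact wedge_der_of_mem (by simp [orientationSet, hn, he, heT]) hω

theorem mark_unmarkOrientation_self (heT : e ∈ Γ.T) {ω : Wedge R}
    (hω : ω ∈ orderings R (Γ.orientationSet n)) :
    markOrientation R n e (unmarkOrientation R n e ω) = ω := by
  unfold unmarkOrientation markOrientation
  split_ifs with hn
  · exact wedge_der_of_mem (by simp [orientationSet, hn, heT]) hω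
  · exact der_wedge_of_notMem (by simp [orientationSet, hn, heT]) hω

/-- Multiplication by one symbol and derivation by a different one anticommute. This sign cancels
the off-diagonal terms in `du_markBridges_add`. -/
theorem unmark_markOrientation (hne : e ≠ f) (ω : Wedge R) :
    unmarkOrientation R n f (markOrientation R n e ω) =
      - markOrientation R n e (unmarkOrientation R n f ω) := by
  have h : Label.edge e ≠ .edge f := fun h => hne (Label.edge.inj h)
  unfold unmarkOrientation markOrientation
  split_ifs
  · exact der_wedge_ne h.symm ω
  · rw [der_wedge_ne h, neg_neg]

theorem unmark_mark_self (heT : e ∉ Γ.T) : (Γ.mark e).unmark e = Γ := by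
  ext1 <;> simp [mark, unmark, heT]

theorem mark_unmark_self (heT : e ∈ Γ.T) : (Γ.unmark e).mark e = Γ := by
  ext1 <;> simp [mark, unmark, heT]

theorem unmark_mark (hne : e ≠ f) : (Γ.mark e).unmark f = (Γ.unmark f).mark e := by
  ext1
  · rfl
  · rfl
  · rfl
  · exact Finset.erase_insert_of_ne hne

end MarkedGraph

/-! ### The averaged bridge-marking operator -/

section Homotopy

variable [Algebra ℚ R]

variable (R n r) in
/-- The operator that marks the unmarked bridges and divides by the number of all bridges, before
passing to isomorphism classes. -/
def preMarkBridges : (MarkedGraph r →₀ Wedge R) →ₗ[R] (MarkedGraph r →₀ Wedge R) :=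
  Finsupp.lsum R fun Γ => algebraMap ℚ R (Γ.bridges.card : ℚ)⁻¹ • ∑ e ∈ Γ.bridges \ Γ.T,
    Finsupp.lsingle (Γ.mark e) ∘ₗ MarkedGraph.markOrientation R n e

theorem preMarkBridges_single (Γ : MarkedGraph r) (ω : Wedge R) :
    (isoRelations R r).mkQ (preMarkBridges R n r (Finsupp.single Γ ω)) =
      algebraMap ℚ R (Γ.bridges.card : ℚ)⁻¹ • ∑ e ∈ Γ.bridges \ Γ.T,
        cls (Γ.mark e) (MarkedGraph.markOrientation R n e ω) := by
  simp only [preMarkBridges, Finsupp.lsum_single, LinearMap.smul_apply, map_smul,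
    LinearMap.sum_apply, map_sum]
  rfl

variable (R n r) in
/-- The operator that marks the unmarked bridges and divides by the number of all bridges. -/
def markBridges : Ambient R r →ₗ[R] Ambient R r :=
  (isoRelations R r).liftQ ((isoRelations R r).mkQ ∘ₗ preMarkBridges R n r) <| by
    refine Submodule.span_le.2 ?_
    rintro _ ⟨Γ, σ, ω, rfl⟩
    have hσ := Sym2.map.injective σ.injective
    have hT : (Γ.relabel σ).T = Γ.T.image (Sym2.map σ) := rfl
    -- Relabelling permutes the unmarked bridges and preserves the number of all bridges, so the two
    -- sums agree term by term up to isomorphism.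
    rw [SetLike.mem_coe, LinearMap.mem_ker, LinearMap.comp_apply, map_sub, map_sub,
      preMarkBridges_single, preMarkBridges_single, sub_eq_zero, Γ.bridges_relabel, hT,
      Finset.card_image_of_injective _ hσ, ← Finset.image_sdiff _ _ hσ,
      Finset.sum_image hσ.injOn]
    congr 1
    refine Finset.sum_congr rfl fun e _ => ?_
    rw [Γ.mark_relabel, MarkedGraph.markOrientation_relabel, cls_relabel]

theorem markBridges_cls (Γ : MarkedGraph r) (ω : Wedge R) : markBridges R n r (cls Γ ω) =
    algebraMap ℚ R (Γ.bridges.card : ℚ)⁻¹ • ∑ e ∈ Γ.bridges \ Γ.T,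
      cls (Γ.mark e) (MarkedGraph.markOrientation R n e ω) :=
  preMarkBridges_single Γ ω

/-- The sum is empty, so the coefficient, which is the default value $0^{-1} = 0$, plays no role. -/
theorem markBridges_cls_of_bridgeless {Γ : MarkedGraph r} (h : Γ.Bridgeless) (ω : Wedge R) :
    markBridges R n r (cls Γ ω) = 0 := by
  rw [markBridges_cls, MarkedGraph.bridges_eq_empty_iff.2 h]
  simp

/-- A general `P` serves two uses: no condition at all, and a bound on the number of edges, which
marking leaves unchanged. -/
theorem markBridges_cls_mem {P : MarkedGraph r → Prop} {g m : ℕ} {Γ : MarkedGraph r}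
    (hΓ : Γ.Admissible) (hg : Γ.HasLoopOrder g) (hm : Γ.T.card = m) (hP : ∀ e, P (Γ.mark e))
    {ω : Wedge R} (hω : ω ∈ orderings R (Γ.orientationSet n)) :
    markBridges R n r (cls Γ ω) ∈ graphSpan R n P g (m + 1) := by
  rw [markBridges_cls]
  refine Submodule.smul_mem _ _ (sum_mem fun e he => ?_)
  rw [Finset.mem_sdiff, MarkedGraph.mem_bridges] at he
  refine cls_mem_graphSpan (he.1.admissible_mark hΓ he.2) hg ?_ (hP e)
    (MarkedGraph.markOrientation_mem he.1.1 he.2 hω)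
  rw [← hm]
  exact Finset.card_insert_of_notMem he.2

theorem markBridges_mem {g m : ℕ} {x : Ambient R r}
    (hx : x ∈ graphSpan R n (fun _ : MarkedGraph r => True) g m) :
    markBridges R n r x ∈ graphSpan R n (fun _ : MarkedGraph r => True) g (m + 1) := by
  induction hx using Submodule.span_induction with
  | mem x h =>
    obtain ⟨Γ, ω, hΓ, hg, hm, -, hω, rfl⟩ := h
    exact markBridges_cls_mem hΓ hg hm (fun _ => trivial) (Submodule.subset_span hω)
  | zero => simp
  | add a b _ _ ha hb => rw [map_add]; exact add_mem ha hb
  | smul c a _ ha => rw [map_smul]; exact Submodule.smul_mem _ _ ha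

theorem markBridges_eq_zero {g m : ℕ} {x : Ambient R r}
    (hx : x ∈ graphSpan R n (MarkedGraph.Bridgeless (r := r)) g m) : markBridges R n r x = 0 := by
  induction hx using Submodule.span_induction with
  | mem x h =>
    obtain ⟨Γ, ω, -, -, -, hb, -, rfl⟩ := h
    exact markBridges_cls_of_bridgeless hb ω
  | zero => simp
  | add a b _ _ ha hb => rw [map_add, ha, hb, add_zero]
  | smul c a _ ha => rw [map_smul, ha, smul_zero]

/-- Contraction and unmarking create no bridges, so the homotopy kills every term. Arguing on
generators covers all degrees at once, including degree 0. -/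
theorem markBridges_differential_eq_zero {g m : ℕ} {x : Ambient R r}
    (hx : x ∈ graphSpan R n (MarkedGraph.Bridgeless (r := r)) g m) :
    markBridges R n r (differential R n r x) = 0 := by
  induction hx using Submodule.span_induction with
  | mem x h =>
    obtain ⟨Γ, ω, hΓ, -, -, hb, -, rfl⟩ := h
    rw [differential_cls, map_sum]
    refine Finset.sum_eq_zero fun e he => ?_
    have := isStable_bridgeless Γ hΓ hb e he
    rw [map_add, markBridges_cls_of_bridgeless this.1, markBridges_cls_of_bridgeless this.2,
      add_zero]
  | zero => simp
  | add a b _ _ ha hb => rw [map_add, map_add, ha, hb, add_zero]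
  | smul c a _ ha => rw [map_smul, map_smul, ha, smul_zero]

/-! ### The homotopy identity for the unmarking differential -/

/-- Marking bridges is a contracting homotopy for the unmarking differential on the graphs with
bridges. -/
theorem du_markBridges_add {Γ : MarkedGraph r} (hb : ¬ Γ.Bridgeless) {ω : Wedge R}
    (hω : ω ∈ orderings R (Γ.orientationSet n)) :
    du R n r (markBridges R n r (cls Γ ω)) + markBridges R n r (du R n r (cls Γ ω)) =
      cls Γ ω := by
  have hB : (Γ.bridges.card : ℚ) ≠ 0 := by
    rwa [Nat.cast_ne_zero, Ne, Finset.card_eq_zero, MarkedGraph.bridges_eq_empty_iff]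
  let F : Sym2 ℕ → Sym2 ℕ → Ambient R r := fun e f =>
    cls ((Γ.mark e).unmark f)
      (MarkedGraph.unmarkOrientation R n f (MarkedGraph.markOrientation R n e ω))
  let G : Sym2 ℕ → Sym2 ℕ → Ambient R r := fun e f =>
    cls ((Γ.unmark f).mark e)
      (MarkedGraph.markOrientation R n e (MarkedGraph.unmarkOrientation R n f ω))
  have hFG : ∀ e f, e ≠ f → F e f = - G e f := by
    intro e f hne
    simp only [F, G]
    rw [MarkedGraph.unmark_mark hne, MarkedGraph.unmark_markOrientation hne, map_neg]
  -- After an unmarked bridge `e` is marked, unmarking `e` again returns `Γ`; the terms `F e f`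
  -- unmark a previously marked edge.
  have h1 : du R n r (markBridges R n r (cls Γ ω)) = algebraMap ℚ R (Γ.bridges.card : ℚ)⁻¹ •
      ∑ e ∈ Γ.bridges \ Γ.T, (cls Γ ω + ∑ f ∈ Γ.T, F e f) := by
    rw [markBridges_cls, map_smul, map_sum]
    congr 1
    refine Finset.sum_congr rfl fun e he => ?_
    rw [Finset.mem_sdiff, MarkedGraph.mem_bridges] at he
    rw [du_cls]
    change ∑ f ∈ insert e Γ.T, F e f = _
    rw [Finset.sum_insert he.2]
    congr 1
    simp only [F]
    rw [MarkedGraph.unmark_mark_self he.2,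
      MarkedGraph.unmark_markOrientation_self he.1.1 he.2 hω]
  -- Here `Γ` returns once for each marked bridge `f`, unmarked and then marked again. The
  -- denominator is the same as before, since unmarking does not affect which edges are bridges.
  have h2 : markBridges R n r (du R n r (cls Γ ω)) = algebraMap ℚ R (Γ.bridges.card : ℚ)⁻¹ •
      ((∑ f ∈ Γ.T ∩ Γ.bridges, cls Γ ω) + ∑ f ∈ Γ.T, ∑ e ∈ Γ.bridges \ Γ.T, G e f) := by
    rw [du_cls, map_sum, ← Finset.filter_mem_eq_inter, Finset.sum_filter,
      ← Finset.sum_add_distrib, Finset.smul_sum]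
    refine Finset.sum_congr rfl fun f hf => ?_
    rw [markBridges_cls]
    change algebraMap ℚ R (Γ.bridges.card : ℚ)⁻¹ • ∑ e ∈ Γ.bridges \ Γ.T.erase f, G e f = _
    congr 1
    split_ifs with hfb
    -- A bridge `f` that has just been unmarked joins the unmarked bridges and contributes the
    -- diagonal term.
    · rw [Finset.sdiff_erase hfb, Finset.sum_insert (by simp [hf])]
      congr 1
      simp only [G]
      rw [MarkedGraph.mark_unmark_self hf, MarkedGraph.mark_unmarkOrientation_self hf hω]
    · rw [zero_add]
      refine Finset.sum_congr ?_ fun _ _ => rfl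
      ext e
      simp only [Finset.mem_sdiff, Finset.mem_erase, not_and]
      refine and_congr_right fun he => ⟨fun h => h fun h' => hfb (h' ▸ he), fun h _ => h⟩
  have h3 : ∑ e ∈ Γ.bridges \ Γ.T, ∑ f ∈ Γ.T, F e f = - ∑ f ∈ Γ.T, ∑ e ∈ Γ.bridges \ Γ.T, G e f := by
    rw [Finset.sum_comm, ← Finset.sum_neg_distrib]
    refine Finset.sum_congr rfl fun f hf => ?_
    rw [← Finset.sum_neg_distrib]
    refine Finset.sum_congr rfl fun e he => hFG e f ?_
    rintro rfl
    exact (Finset.mem_sdiff.1 he).2 hf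
  -- Unmarked bridges from `h1` and marked ones from `h2` add up to all bridges, which is why the
  -- operator divides by the number of all bridges and not only of the unmarked ones.
  have h4 : (Γ.bridges \ Γ.T).card + (Γ.T ∩ Γ.bridges).card = Γ.bridges.card := by
    rw [Finset.inter_comm, Finset.card_sdiff_add_card_inter]
  rw [h1, h2, ← smul_add, Finset.sum_add_distrib, h3, Finset.sum_const, Finset.sum_const]
  have h5 : ∀ (p q : ℕ) (c s : Ambient R r), p • c + -s + (q • c + s) = (p + q) • c := by
    intro p q c s
    rw [add_smul]
    abel
  rw [h5, h4, ← Nat.cast_smul_eq_nsmul R, smul_smul, ← map_natCast (algebraMap ℚ R), ← map_mul,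
    inv_mul_cancel₀ hB, map_one, one_smul]

/-! ### Induction on the number of edges -/

/-- Up to graphs with fewer edges, marking bridges is a contracting homotopy on the graphs with
bridges. -/
theorem sub_differential_markBridges_mem {g m k : ℕ} {Γ : MarkedGraph r} (hΓ : Γ.Admissible)
    (hg : Γ.HasLoopOrder g) (hm : Γ.T.card = m) (hk : Γ.E.card < k + 1) (hb : ¬ Γ.Bridgeless)
    {ω : Wedge R} (hω : ω ∈ orderings R (Γ.orientationSet n)) :
    cls Γ ω - differential R n r (markBridges R n r (cls Γ ω)) -
      markBridges R n r (differential R n r (cls Γ ω)) ∈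
        graphSpan R n (fun Γ : MarkedGraph r => Γ.E.card < k) g m := by
  have hE : ∀ {e}, e ∈ Γ.E → (Γ.E.erase e).card < k := fun he => by
    have := Finset.card_erase_add_one he
    omega
  have h1 : dc R n r (markBridges R n r (cls Γ ω)) ∈
      graphSpan R n (fun Γ : MarkedGraph r => Γ.E.card < k) g m := by
    rw [markBridges_cls, map_smul, map_sum]
    refine Submodule.smul_mem _ _ (sum_mem fun e he => ?_)
    rw [Finset.mem_sdiff, MarkedGraph.mem_bridges] at he
    have hΓ' := he.1.admissible_mark hΓ he.2
    have hω' := MarkedGraph.markOrientation_mem he.1.1 he.2 hω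
    rw [dc_cls]
    refine sum_mem fun f hf => ?_
    have hc := (Γ.mark e).contractOrientation_mem hΓ' hf hω'
    have hfE : f ∈ Γ.E := hΓ'.marked_subset hf
    -- Marking `e` raises the degree by one and contracting `f` lowers it again. The edge `f` may be
    -- `e` itself.
    have hcard : ((Γ.mark e).T.erase f).card = m := by
      have h := Finset.card_erase_add_one hf
      have h' : (Γ.mark e).T.card = _ := Finset.card_insert_of_notMem he.2
      omega
    induction f using Sym2.ind with | _ a b => ?_
    obtain ⟨v, w, h⟩ := hΓ'.edgeAt hf
    exact cls_mem_graphSpan (h.admissible_contract hΓ') (h.loopOrder_contract hΓ' hg) hcard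
      (hE hfE) hc
  have h2 : markBridges R n r (dc R n r (cls Γ ω)) ∈
      graphSpan R n (fun Γ : MarkedGraph r => Γ.E.card < k) g m := by
    rw [dc_cls, map_sum]
    refine sum_mem fun f hf => ?_
    have hc := Γ.contractOrientation_mem hΓ hf hω
    have hfE : f ∈ Γ.E := hΓ.marked_subset hf
    have hcard : (Γ.T.erase f).card + 1 = m := (Finset.card_erase_add_one hf).trans hm
    rw [← hcard]
    induction f using Sym2.ind with | _ a b => ?_
    obtain ⟨v, w, h⟩ := hΓ.edgeAt hf
    exact markBridges_cls_mem (h.admissible_contract hΓ) (h.loopOrder_contract hΓ hg) rfl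
      (fun _ => hE hfE) hc
  have h3 := du_markBridges_add hb hω
  -- The unmarking parts add up to `cls Γ ω` by `h3` and cancel it; only the contraction parts
  -- remain, and each of them loses an edge.
  have h4 : cls Γ ω - differential R n r (markBridges R n r (cls Γ ω)) -
      markBridges R n r (differential R n r (cls Γ ω)) =
      - dc R n r (markBridges R n r (cls Γ ω)) - markBridges R n r (dc R n r (cls Γ ω)) := by
    rw [← sub_eq_zero]
    simp only [differential, LinearMap.add_apply, map_add]
    nth_rw 1 [← h3]
    abel
  rw [h4]
  exact sub_mem (neg_mem h1) h2

/-- Subtract $d(hz)$ from $z$. Since $h(dz) = 0$, the difference equals $(1 - dh - hd)z$, so it is a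
sum $w + a$ with $w$ supported on graphs with fewer edges and $a$ bridgeless. The hypothesis passes
to $w$, because $hd$ kills both $d(hz)$ and $a$, and the induction continues with $w$. -/
theorem exists_eq_add_differential_of_card_lt (g m k : ℕ) : ∀ z ∈ graphSpan R n
    (fun Γ : MarkedGraph r => Γ.E.card < k) g m,
    markBridges R n r (differential R n r z) = 0 →
    ∃ a ∈ graphSpan R n (MarkedGraph.Bridgeless (r := r)) g m,
      ∃ y ∈ graphSpan R n (fun _ : MarkedGraph r => True) g (m + 1),
        z = a + differential R n r y := by
  have hle : ∀ k, graphSpan R n (fun Γ : MarkedGraph r => Γ.E.card < k) g m ≤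
      graphSpan R n (fun _ => True) g m := fun k =>
    Submodule.span_mono fun _ ⟨Γ, ω, h1, h2, h3, _, h5⟩ => ⟨Γ, ω, h1, h2, h3, trivial, h5⟩
  induction k with
  | zero =>
    intro z hz hDz
    have : z = 0 := by
      clear hDz
      induction hz using Submodule.span_induction with
      | mem x h =>
        obtain ⟨Γ, ω, -, -, -, h, -⟩ := h
        exact absurd h (Nat.not_lt_zero _)
      | zero => rfl
      | add a b _ _ ha hb => rw [ha, hb, add_zero]
      | smul c a _ ha => rw [ha, smul_zero]
    exact ⟨0, zero_mem _, 0, zero_mem _, by simp [this]⟩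
  | succ k ih =>
    intro z hz hDz
    have key : z - differential R n r (markBridges R n r z) -
        markBridges R n r (differential R n r z) ∈
        graphSpan R n (fun Γ : MarkedGraph r => Γ.E.card < k) g m ⊔
          graphSpan R n (MarkedGraph.Bridgeless (r := r)) g m := by
      -- The condition on `z` need not hold for the generators of the span, so the decomposition is
      -- proved without it.
      clear hDz
      induction hz using Submodule.span_induction with
      | mem x h =>
        obtain ⟨Γ, ω, hΓ, hg, hm, hk, hω, rfl⟩ := h
        have hω : ω ∈ orderings R (Γ.orientationSet n) := Submodule.subset_span hω
        by_cases hb : Γ.Bridgeless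
        · have := cls_mem_graphSpan (P := MarkedGraph.Bridgeless) hΓ hg hm hb hω
          rw [markBridges_differential_eq_zero this, markBridges_eq_zero this, map_zero, sub_zero,
            sub_zero]
          exact Submodule.mem_sup_right this
        · exact Submodule.mem_sup_left (sub_differential_markBridges_mem hΓ hg hm hk hb hω)
      | zero => simp
      | add a b _ _ ha hb =>
        convert add_mem ha hb using 1
        simp only [map_add]
        abel
      | smul c a _ ha =>
        convert Submodule.smul_mem _ c ha using 1
        simp only [map_smul, smul_sub]
    rw [hDz, sub_zero] at key
    obtain ⟨w, hw, a, ha, hwa⟩ := Submodule.mem_sup.1 key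
    have hy := markBridges_mem (hle _ hz)
    have hw' : w = z - differential R n r (markBridges R n r z) - a := eq_sub_of_add_eq hwa
    obtain ⟨a', ha', y', hy', hw''⟩ := ih w hw (by
      rw [hw', map_sub, map_sub (differential R n r) z, differential_differential _ hy, sub_zero, map_sub, hDz,
        markBridges_differential_eq_zero ha, sub_zero])
    refine ⟨a' + a, add_mem ha' ha, y' + markBridges R n r z, add_mem hy' hy, ?_⟩
    calc z = w + a + differential R n r (markBridges R n r z) := by rw [hw']; abel
      _ = _ := by rw [hw'', map_add]; abel

/-- A given element involves finitely many graphs, so their numbers of edges are bounded; no bound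
in terms of $g$ and $r$ is needed. -/
theorem exists_eq_add_differential {g m : ℕ} {z : Ambient R r}
    (hz : z ∈ graphSpan R n (fun _ : MarkedGraph r => True) g m)
    (hDz : markBridges R n r (differential R n r z) = 0) :
    ∃ a ∈ graphSpan R n (MarkedGraph.Bridgeless (r := r)) g m,
      ∃ y ∈ graphSpan R n (fun _ : MarkedGraph r => True) g (m + 1),
        z = a + differential R n r y := by
  suffices ∃ k, z ∈ graphSpan R n (fun Γ : MarkedGraph r => Γ.E.card < k) g m by
    obtain ⟨k, hk⟩ := this
    exact exists_eq_add_differential_of_card_lt g m k z hk hDz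
  have hmono : ∀ {k l : ℕ}, k ≤ l → graphSpan R n (fun Γ : MarkedGraph r => Γ.E.card < k) g m ≤
      graphSpan R n (fun Γ : MarkedGraph r => Γ.E.card < l) g m := fun hkl =>
    Submodule.span_mono fun _ ⟨Γ, ω, h1, h2, h3, h4, h5⟩ =>
      ⟨Γ, ω, h1, h2, h3, h4.trans_le hkl, h5⟩
  clear hDz
  induction hz using Submodule.span_induction with
  | mem x h =>
    obtain ⟨Γ, ω, hΓ, hg, hm, -, hω, rfl⟩ := h
    exact ⟨_, cls_mem_graphSpan hΓ hg hm (Nat.lt_succ_self _) (Submodule.subset_span hω)⟩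
  | zero => exact ⟨0, zero_mem _⟩
  | add a b _ _ ha hb =>
    obtain ⟨k, hk⟩ := ha
    obtain ⟨l, hl⟩ := hb
    exact ⟨max k l, add_mem (hmono (le_max_left _ _) hk) (hmono (le_max_right _ _) hl)⟩
  | smul c a _ ha =>
    obtain ⟨k, hk⟩ := ha
    exact ⟨k, Submodule.smul_mem _ c hk⟩

end Homotopy

/-! ### Return to the chain complexes -/

theorem graphComplex_d_apply {P : MarkedGraph r → Prop} (hP : IsStable P) (g m : ℕ)
    (x : graphSpan R n P g (m + 1)) :
    ((graphComplex R n P hP g).d (m + 1) m x : graphSpan R n P g m).1 =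
      differential R n r x.1 := by
  have h : (graphComplex R n P hP g).d (m + 1) m =
      ModuleCat.ofHom ((differential R n r).restrict (differential_mem (m := m) hP)) :=
    ChainComplex.of_d (fun m => ModuleCat.of R (graphSpan R n P g m))
      (fun m => ModuleCat.ofHom ((differential R n r).restrict (differential_mem (m := m) hP))) m
  rw [h]
  rfl

theorem differential_eq_zero {P : MarkedGraph r → Prop} {g : ℕ} {x : Ambient R r}
    (hx : x ∈ graphSpan R n P g 0) : differential R n r x = 0 := by
  induction hx using Submodule.span_induction with
  | mem x h =>
    obtain ⟨Γ, ω, -, -, hm, -, -, rfl⟩ := h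
    rw [differential_cls, Finset.card_eq_zero.1 hm, Finset.sum_empty]
  | zero => simp
  | add a b _ _ ha hb => rw [map_add, ha, hb, add_zero]
  | smul c a _ ha => rw [map_smul, ha, smul_zero]

/-- The boundary case is `j = 0`, where `next 0 = 0` and the differential of the complex vanishes by
its shape. The operator vanishes there too, as no edge is marked. -/
theorem graphComplex_d_eq_zero_iff {P : MarkedGraph r → Prop} (hP : IsStable P) (g : ℕ) {j k : ℕ}
    (hk : (ComplexShape.down ℕ).next j = k) (x : graphSpan R n P g j) :
    (graphComplex R n P hP g).d j k x = 0 ↔ differential R n r x.1 = 0 := by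
  cases j with
  | zero =>
    have h : (graphComplex R n P hP g).d 0 k = 0 := HomologicalComplex.shape _ _ _ (by simp)
    rw [h]
    exact iff_of_true rfl (differential_eq_zero x.2)
  | succ j =>
    obtain rfl : j = k := by rw [← hk]; exact (ChainComplex.next_nat_succ j).symm
    rw [← graphComplex_d_apply hP]
    exact Subtype.ext_iff

/-- The inclusion of the bridgeless forested graph complex is a quasi-isomorphism in every loop
order. -/
theorem quasiIso_blInclusion [Algebra ℚ R] (g : ℕ) : QuasiIso (blInclusion R n r g) := by
  refine ChainComplex.quasiIso_of_forall_exists _ ?_ ?_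
  · intro i j hi x y hxy
    obtain rfl : j + 1 = i := by rw [← hi]; exact (ChainComplex.prev ℕ j).symm
    have hxy : x.1 = differential R n r y.1 :=
      (congrArg Subtype.val hxy).trans (graphComplex_d_apply isStable_true g j y)
    -- Injectivity: the boundary of `y` is the bridgeless `x`, which the homotopy kills. So `y` is
    -- bridgeless up to a boundary, and its bridgeless part `a` also has boundary `x`.
    obtain ⟨a, ha, w, hw, h⟩ := exists_eq_add_differential y.2 (by
      rw [← hxy]; exact markBridges_eq_zero x.2)
    refine ⟨⟨a, ha⟩, Subtype.ext ?_⟩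
    refine Eq.trans ?_ (graphComplex_d_apply isStable_bridgeless g j ⟨a, ha⟩).symm
    rw [hxy, h, map_add, differential_differential w hw, add_zero]
  · intro i j k hi hk y hy
    obtain rfl : j + 1 = i := by rw [← hi]; exact (ChainComplex.prev ℕ j).symm
    have hDy := (graphComplex_d_eq_zero_iff isStable_true g hk y).1 hy
    -- Surjectivity: the cycle `y` is homologous to its bridgeless part `a`, which is then a cycle
    -- as well.
    obtain ⟨a, ha, w, hw, h⟩ := exists_eq_add_differential y.2 (by rw [hDy, map_zero])
    refine ⟨⟨a, ha⟩, ⟨w, hw⟩, ?_, Subtype.ext ?_⟩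
    · refine (graphComplex_d_eq_zero_iff isStable_bridgeless g hk ⟨a, ha⟩).2 ?_
      rwa [h, map_add, differential_differential w hw, add_zero] at hDy
    · refine h.trans (congrArg (a + ·) ?_)
      exact (graphComplex_d_apply isStable_true g j ⟨w, hw⟩).symm

end ForestedGraphs

end

theorem mainTheorem3 (R : Type*) [CommRing R] [Algebra ℚ R] (n : ℤ) (r g : ℕ) (hg : 1 ≤ g) :
    QuasiIso (ForestedGraphs.blInclusion R n r g) :=
  ForestedGraphs.quasiIso_blInclusion g
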